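/- Let $\varphi:(0,\infty)\to(0,\infty)$ satisfy: (i) $\varphi\in C^1((0,\infty))$; (ii) $(s\varphi(s))'>0$ for all $s>0$; (iii) the range of $s\mapsto s\varphi(s)$ on $(0,\infty)$ is $(0,\infty)$; (iv) there are $s_0>0$, $C_1,C_2>0$ and $r>-1$ with $C_1s^r\le(s\varphi(s))'\le C_2s^r$ for $s\in(0,s_0)$, and, if $r=0$, moreover $\lim_{s\to0^+}\varphi(s)$ exists, is finite and positive, and $\lim_{s\to0^+}s\varphi'(s)=0$; (v) there is $s_1>s_0$ such that either $\varphi'(s)\ge0$ for all $s\ge s_1$ or $\varphi'(s)\le0$ for all $s\ge s_1$; (vi) $|s\varphi'(s)/\varphi(s)|$ is non-decreasing on $(0,\infty)$. Define $\Lambda$ on $(0,\infty)$ by $$\Lambda\bigl(s\sqrt{\varphi(s)}\bigr)=-\frac{s\varphi'(s)}{s\varphi'(s)+2\varphi(s)}\quad(s>0),\qquad \Lambda_\infty=\lim_{t\to\infty}\Lambda(t).$$ Let $\Omega\subset\mathbb R^n$ be a domain (open and connected), $m\ge1$. A system $\partial_h(\mathscr A^{hk}\partial_k)$ with $m\times m$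 complex matrix coefficients with entries in $L^1_{\mathrm{loc}}(\Omega)$ (sums over $h,k=1,\dots,n$) is called $L^\Phi$-dissipative if $$\operatorname{Re}\int_\Omega\sum_{h,k}\langle\mathscr A^{hk}\partial_ku,\partial_h(\varphi(|u|)u)\rangle\,dx\ge0$$ for all $u\in[C_0^1(\Omega)]^m$ ($\mathbb C^m$-valued, $C^1$, compactly supported in $\Omega$) such that $\varphi(|u|)u\in[C^1_0(\Omega)]^m$, where $\varphi(|u|)u$ is read as $0$ where $u=0$. Let $\mathscr A^h$ ($h=1,\dots,n$) be real $m\times m$ matrix functions on $\Omega$ with entries in $L^1_{\mathrm{loc}}(\Omega)$ such that, for almost every $x\in\Omega$, $\mathscr A^h(x)$ is symmetric and $\langle\mathscr A^h(x)\xi,\xi\rangle>0$ for every $\xi\in\mathbb R^m\setminus\{0\}$. Let $\mu_1^h(x)$ and $\mu_m^h(x)$ be the smallest and the largest eigenvalue of $\mathscr A^h(x)$. Then the operator $Au=\sum_h\partial_h(\mathscr A^h\partial_hu)$ is $L^\Phi$-dissipative if and only if $$\Lambda_\infty^2\,(\mu_1^h(x)+\mu_m^h(x))^2\le4\,\mu_1^h(x)\,\mu_m^h(x)\qquad\text{for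 almost every }x\in\Omega,\ h=1,\dots,n.$$ If $m=2$, this condition is equivalent to $$\Lambda_\infty^2\,(\operatorname{tr}\mathscr A^h(x))^2\le4\det\mathscr A^h(x)\qquad\text{for almost every }x\in\Omega,\ h=1,\dots,n.$$ -/

import Mathlib

open MeasureTheory Set Filter Topology

noncomputable section

namespace FunctionalDissipativity

/-- The standing conditions on the positive function `φ` on `(0, ∞)`.
Only the values of `φ` on `(0, ∞)` matter. -/
structure Admissible (φ : ℝ → ℝ) : Prop where
  pos : ∀ s, 0 < s → 0 < φ s
  contDiffOn : ContDiffOn ℝ 1 φ (Ioi 0)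
  deriv_pos : ∀ s, 0 < s → 0 < deriv (fun t => t * φ t) s
  range_eq : (fun s => s * φ s) '' Ioi 0 = Ioi 0
  growth : ∃ s₀ : ℝ, 0 < s₀ ∧
    (∃ C₁ C₂ r : ℝ, 0 < C₁ ∧ 0 < C₂ ∧ -1 < r ∧
      (∀ s ∈ Ioo 0 s₀, C₁ * s ^ r ≤ deriv (fun t => t * φ t) s ∧
        deriv (fun t => t * φ t) s ≤ C₂ * s ^ r) ∧
      (r = 0 → (∃ φ₀ : ℝ, 0 < φ₀ ∧ Tendsto φ (𝓝[>] 0) (𝓝 φ₀)) ∧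
        Tendsto (fun s => s * deriv φ s) (𝓝[>] 0) (𝓝 0))) ∧
    (∃ s₁ : ℝ, s₀ < s₁ ∧
      ((∀ s, s₁ ≤ s → 0 ≤ deriv φ s) ∨ (∀ s, s₁ ≤ s → deriv φ s ≤ 0)))
  monotone_abs : MonotoneOn (fun s => |s * deriv φ s / φ s|) (Ioi 0)

/-- The inverse of `s ↦ s √(φ s)` on `(0, ∞)`. -/
def radius (φ : ℝ → ℝ) (t : ℝ) : ℝ :=
  Function.invFunOn (fun s => s * √(φ s)) (Ioi 0) t

/-- The function `Λ` on `(0, ∞)` determined by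
`Λ (s √(φ s)) = - s φ'(s) / (s φ'(s) + 2 φ(s))` for `s > 0`. -/
def Lam (φ : ℝ → ℝ) (t : ℝ) : ℝ :=
  -(radius φ t * deriv φ (radius φ t) /
    (radius φ t * deriv φ (radius φ t) + 2 * φ (radius φ t)))

/-- `Λ_∞ = lim_{t → ∞} Λ(t)`; the limit exists by `tendsto_Lam`. -/
def LamInf (φ : ℝ → ℝ) : ℝ := limUnder atTop (Lam φ)

/-- The partial derivative `∂_k u`. -/
def pderiv {n m : ℕ} (k : Fin n)
    (u : EuclideanSpace ℝ (Fin n) → EuclideanSpace ℂ (Fin m)) (x : EuclideanSpace ℝ (Fin n)) :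
    EuclideanSpace ℂ (Fin m) :=
  fderiv ℝ u x (EuclideanSpace.single k 1)

/-- The space `[C₀¹(Ω)]^m` of `ℂ^m`-valued `C¹` functions with compact support in `Ω`
(extended by zero to the whole space). -/
def IsTest {n m : ℕ} (Ω : Set (EuclideanSpace ℝ (Fin n)))
    (u : EuclideanSpace ℝ (Fin n) → EuclideanSpace ℂ (Fin m)) : Prop :=
  ContDiff ℝ 1 u ∧ HasCompactSupport u ∧ tsupport u ⊆ Ω

/-- The function `φ(|u|) u`, which is zero where `u` vanishes. -/
def phiMul {n m : ℕ} (φ : ℝ → ℝ)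
    (u : EuclideanSpace ℝ (Fin n) → EuclideanSpace ℂ (Fin m)) (x : EuclideanSpace ℝ (Fin n)) :
    EuclideanSpace ℂ (Fin m) :=
  φ ‖u x‖ • u x

/-- `L^Φ`-dissipativity of the system `∂_h (𝒜^{hk} ∂_k)` in `Ω`:
`Re ∫_Ω ∑_{h,k} ⟨𝒜^{hk} ∂_k u, ∂_h (φ(|u|) u)⟩ dx ≥ 0` for all `u ∈ [C₀¹(Ω)]^m` such that
`φ(|u|) u ∈ [C₀¹(Ω)]^m`. The product `⟨a, b⟩ = ∑ᵢ aᵢ conj bᵢ` is linear in the first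
entry, hence it is Mathlib's `inner ℂ b a`. -/
def LPhiDissipative {n m : ℕ} (φ : ℝ → ℝ) (Ω : Set (EuclideanSpace ℝ (Fin n)))
    (𝒜 : Fin n → Fin n → EuclideanSpace ℝ (Fin n) → Matrix (Fin m) (Fin m) ℂ) : Prop :=
  ∀ u : EuclideanSpace ℝ (Fin n) → EuclideanSpace ℂ (Fin m),
    IsTest Ω u → IsTest Ω (phiMul φ u) →
    0 ≤ (∫ x in Ω, ∑ h, ∑ k,
      inner ℂ (pderiv h (phiMul φ u) x)
        (WithLp.toLp 2 ((𝒜 h k x).mulVec (WithLp.ofLp (pderiv k u x))))).re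

/-- The coefficients `𝒜^{hk} = δ_{hk} A^h` of the operator `∂_h (A^h ∂_h)` with real
matrices `A^h`, regarded as a system with complex coefficients. -/
def diagCoeff {n m : ℕ}
    (A : Fin n → EuclideanSpace ℝ (Fin n) → Matrix (Fin m) (Fin m) ℝ) :
    Fin n → Fin n → EuclideanSpace ℝ (Fin n) → Matrix (Fin m) (Fin m) ℂ :=
  fun h k x => if h = k then (A h x).map Complex.ofReal else 0

/-- The smallest eigenvalue of a real symmetric matrix of positive size. -/
def minEigenvalue {m : ℕ} (M : Matrix (Fin m) (Fin m) ℝ) : ℝ :=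
  sInf {μ : ℝ | Module.End.HasEigenvalue (Matrix.toLin' M) μ}

/-- The largest eigenvalue of a real symmetric matrix of positive size. -/
def maxEigenvalue {m : ℕ} (M : Matrix (Fin m) (Fin m) ℝ) : ℝ :=
  sSup {μ : ℝ | Module.End.HasEigenvalue (Matrix.toLin' M) μ}

/-! ### `Λ` and `Λ_∞` are well defined -/

theorem Admissible.strictMonoOn {φ : ℝ → ℝ} (hφ : Admissible φ) :
    StrictMonoOn (fun s => s * √(φ s)) (Ioi 0) := by
  have h1 : StrictMonoOn (fun s => s * φ s) (Ioi 0) := by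
    apply strictMonoOn_of_deriv_pos (convex_Ioi 0)
    · exact continuousOn_id.mul hφ.contDiffOn.continuousOn
    · intro s hs
      rw [interior_Ioi] at hs
      exact hφ.deriv_pos s hs
  intro s hs t ht hst
  have hs' : 0 < s := hs
  have ht' : 0 < t := ht
  have h2 : s * φ s < t * φ t := h1 hs ht hst
  have h3 := hφ.pos s hs
  have h4 := hφ.pos t ht
  show s * √(φ s) < t * √(φ t)
  apply lt_of_pow_lt_pow_left₀ 2 (by positivity)
  rw [mul_pow, mul_pow, Real.sq_sqrt h3.le, Real.sq_sqrt h4.le]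
  have h5 : s * (s * φ s) < t * (t * φ t) := by
    have := mul_pos hs' h3
    nlinarith
  nlinarith

theorem Admissible.surjOn {φ : ℝ → ℝ} (hφ : Admissible φ) :
    SurjOn (fun s => s * √(φ s)) (Ioi 0) (Ioi 0) := by
  have h1 : StrictMonoOn (fun s => s * φ s) (Ioi 0) := by
    apply strictMonoOn_of_deriv_pos (convex_Ioi 0)
    · exact continuousOn_id.mul hφ.contDiffOn.continuousOn
    · intro s hs
      rw [interior_Ioi] at hs
      exact hφ.deriv_pos s hs
  have hone : (1 : ℝ) ∈ Ioi (0 : ℝ) := by simp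
  have hφ1 := hφ.pos 1 one_pos
  intro t ht
  have ht' : 0 < t := ht
  have hsq : ∀ s, 0 < s → (s * √(φ s)) ^ 2 = s * (s * φ s) := by
    intro s hs
    rw [mul_pow, Real.sq_sqrt (hφ.pos s hs).le]
    ring
  obtain ⟨a, ha, hae⟩ : min (t ^ 2) (φ 1) ∈ (fun s => s * φ s) '' Ioi 0 := by
    rw [hφ.range_eq]; exact lt_min (by positivity) hφ1
  obtain ⟨b, hb, hbe⟩ : max (t ^ 2) (φ 1) ∈ (fun s => s * φ s) '' Ioi 0 := by
    rw [hφ.range_eq]; exact lt_max_of_lt_right hφ1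
  have ha0 : 0 < a := ha
  have hb0 : 0 < b := hb
  simp only at hae hbe
  have ha1 : a ≤ 1 := by
    rw [← h1.le_iff_le ha hone]
    simp only [hae, one_mul]
    exact min_le_right _ _
  have hb1 : 1 ≤ b := by
    rw [← h1.le_iff_le hone hb]
    simp only [hbe, one_mul]
    exact le_max_right _ _
  have hga : a * √(φ a) ≤ t := by
    apply le_of_sq_le_sq _ ht'.le
    rw [hsq a ha0]
    have h2 : a * φ a ≤ t ^ 2 := hae ▸ min_le_left _ _
    have h3 : 0 < a * φ a := mul_pos ha0 (hφ.pos a ha0)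
    nlinarith
  have hgb : t ≤ b * √(φ b) := by
    apply le_of_sq_le_sq _ (by positivity)
    rw [hsq b hb0]
    have h2 : t ^ 2 ≤ b * φ b := hbe ▸ le_max_left _ _
    have h3 : 0 < b * φ b := mul_pos hb0 (hφ.pos b hb0)
    nlinarith
  have hsub : Icc a b ⊆ Ioi 0 := fun y hy => lt_of_lt_of_le ha0 hy.1
  have hcont : ContinuousOn (fun s => s * √(φ s)) (Icc a b) :=
    continuousOn_id.mul ((hφ.contDiffOn.continuousOn.mono hsub).sqrt)
  obtain ⟨s, hs, hse⟩ := intermediate_value_Icc (ha1.trans hb1) hcont ⟨hga, hgb⟩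
  exact ⟨s, hsub hs, hse⟩

/-- The defining relation of `Λ`. -/
theorem Lam_apply {φ : ℝ → ℝ} (hφ : Admissible φ) {s : ℝ} (hs : 0 < s) :
    Lam φ (s * √(φ s)) = -(s * deriv φ s / (s * deriv φ s + 2 * φ s)) := by
  have h : radius φ (s * √(φ s)) = s :=
    hφ.strictMonoOn.injOn.leftInvOn_invFunOn hs
  simp only [Lam, h]

/-- The limit `Λ_∞` exists. -/
theorem tendsto_Lam {φ : ℝ → ℝ} (hφ : Admissible φ) :
    Tendsto (Lam φ) atTop (𝓝 (LamInf φ)) := by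
  apply tendsto_nhds_limUnder
  have hX1 : ∀ s, 0 < s → -1 < s * deriv φ s / φ s := by
    intro s hs
    have h1 := hφ.deriv_pos s hs
    have hd : DifferentiableAt ℝ φ s :=
      (hφ.contDiffOn.differentiableOn one_ne_zero).differentiableAt (Ioi_mem_nhds hs)
    have h2 : deriv (fun t => t * φ t) s = φ s + s * deriv φ s := by
      have := ((hasDerivAt_id s).mul hd.hasDerivAt).deriv
      simpa [Pi.mul_def] using this
    rw [h2] at h1
    rw [lt_div_iff₀ (hφ.pos s hs)]
    linarith
  have hLX : ∀ s, 0 < s →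
      Lam φ (s * √(φ s)) = -((s * deriv φ s / φ s) / (s * deriv φ s / φ s + 2)) := by
    intro s hs
    have h0 := hφ.pos s hs
    rw [Lam_apply hφ hs]
    field_simp
  have hXc : ContinuousOn (fun s => s * deriv φ s / φ s) (Ioi 0) :=
    (continuousOn_id.mul (hφ.contDiffOn.continuousOn_deriv_of_isOpen isOpen_Ioi le_rfl)).div
      hφ.contDiffOn.continuousOn (fun s hs => (hφ.pos s hs).ne')
  have hXm := hφ.monotone_abs
  generalize hX : (fun s => s * deriv φ s / φ s) = X at hXc
  have hXs : ∀ s, s * deriv φ s / φ s = X s := fun s => by rw [← hX]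
  simp only [hXs] at hX1 hLX hXm
  have hinv : ∀ t, 0 < t → ∃ s, 0 < s ∧ s * √(φ s) = t := fun t ht => by
    obtain ⟨s, hs, he⟩ := hφ.surjOn ht
    exact ⟨s, hs, he⟩
  have hsign : ∀ s₀, 0 < s₀ → ∀ s, s₀ ≤ s → X s = 0 → X s₀ = 0 := by
    intro s₀ h0 s hs hz
    have := hXm h0 (lt_of_lt_of_le h0 hs : (0 : ℝ) < s) hs
    simp only [hz, abs_zero] at this
    exact abs_nonpos_iff.mp this
  have key : ∀ s₀, 0 < s₀ → (∀ s t, s₀ ≤ s → s ≤ t → X s ≤ X t) ∨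
      (∀ s t, s₀ ≤ s → s ≤ t → X t ≤ X s) →
      ∃ l, Tendsto (Lam φ) atTop (𝓝 l) := by
    intro s₀ h0 hmono
    have hg0 : 0 < s₀ * √(φ s₀) := mul_pos h0 (Real.sqrt_pos.mpr (hφ.pos s₀ h0))
    set t₀ := s₀ * √(φ s₀) with ht0
    have hev : (fun t => Lam φ (max t t₀)) =ᶠ[atTop] Lam φ := by
      filter_upwards [eventually_ge_atTop t₀] with t ht
      rw [max_eq_left ht]
    have hmul : ∀ t, t₀ ≤ t → ∃ s, s₀ ≤ s ∧ s * √(φ s) = t := by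
      intro t ht
      obtain ⟨s, hs, he⟩ := hinv t (hg0.trans_le ht)
      refine ⟨s, ?_, he⟩
      rw [← hφ.strictMonoOn.le_iff_le h0 hs]
      simp only [he]
      exact ht
    have hcmp : ∀ t t', t ≤ t' → ∃ s s', s₀ ≤ s ∧ s ≤ s' ∧
        Lam φ (max t t₀) = -(X s / (X s + 2)) ∧
        Lam φ (max t' t₀) = -(X s' / (X s' + 2)) := by
      intro t t' htt
      obtain ⟨s, hs, he⟩ := hmul (max t t₀) (le_max_right _ _)
      obtain ⟨s', hs', he'⟩ := hmul (max t' t₀) (le_max_right _ _)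
      have p : 0 < s := h0.trans_le hs
      have p' : 0 < s' := h0.trans_le hs'
      refine ⟨s, s', hs, ?_, ?_, ?_⟩
      · rw [← hφ.strictMonoOn.le_iff_le p p']
        simp only [he, he']
        exact max_le_max htt le_rfl
      · rw [← he, hLX s p]
      · rw [← he', hLX s' p']
    have hfrac : ∀ x y : ℝ, -1 < x → x ≤ y → x / (x + 2) ≤ y / (y + 2) := by
      intro x y hx hxy
      rw [div_le_div_iff₀ (by linarith) (by linarith)]
      nlinarith
    rcases hmono with hm | hm
    · refine ⟨_, (tendsto_atTop_ciInf (f := fun t => Lam φ (max t t₀)) ?_ ?_).congr' hev⟩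
      · intro t t' htt
        obtain ⟨s, s', h1, h2, h3, h4⟩ := hcmp t t' htt
        simp only [h3, h4]
        exact neg_le_neg (hfrac _ _ (hX1 s (h0.trans_le h1)) (hm s s' h1 h2))
      · refine ⟨-1, ?_⟩
        rintro _ ⟨t, rfl⟩
        obtain ⟨s, s', h1, h2, h3, h4⟩ := hcmp t t le_rfl
        simp only [h3]
        have := hX1 s (h0.trans_le h1)
        apply neg_le_neg
        rw [div_le_one (by linarith)]
        linarith
    · refine ⟨_, (tendsto_atTop_ciSup (f := fun t => Lam φ (max t t₀)) ?_ ?_).congr' hev⟩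
      · intro t t' htt
        obtain ⟨s, s', h1, h2, h3, h4⟩ := hcmp t t' htt
        simp only [h3, h4]
        exact neg_le_neg (hfrac _ _ (hX1 s' (h0.trans_le (h1.trans h2))) (hm s s' h1 h2))
      · refine ⟨1, ?_⟩
        rintro _ ⟨t, rfl⟩
        obtain ⟨s, s', h1, h2, h3, h4⟩ := hcmp t t le_rfl
        simp only [h3]
        have := hX1 s (h0.trans_le h1)
        rw [neg_le, le_div_iff₀ (by linarith)]
        linarith
  by_cases hall : ∀ s, 0 < s → X s = 0
  · apply key 1 one_pos
    left
    intro s t hs hst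
    rw [hall s (by linarith), hall t (by linarith)]
  · push Not at hall
    obtain ⟨s₀, h0, hne⟩ := hall
    have hsub : ∀ s, Icc s₀ s ⊆ Ioi 0 := fun s y hy => lt_of_lt_of_le h0 hy.1
    apply key s₀ h0
    rcases lt_or_gt_of_ne hne with hneg | hpos
    · right
      have hn : ∀ s, s₀ ≤ s → X s < 0 := by
        intro s hs
        by_contra hc
        obtain ⟨y, hy, hye⟩ := intermediate_value_Icc hs (hXc.mono (hsub s))
          (⟨hneg.le, not_lt.mp hc⟩ : (0 : ℝ) ∈ Icc (X s₀) (X s))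
        exact hne (hsign s₀ h0 y hy.1 hye)
      intro s t hs hst
      have := hXm (h0.trans_le hs : (0 : ℝ) < s) (h0.trans_le (hs.trans hst) : (0 : ℝ) < t) hst
      simp only [abs_of_neg (hn s hs), abs_of_neg (hn t (hs.trans hst))] at this
      linarith
    · left
      have hn : ∀ s, s₀ ≤ s → 0 < X s := by
        intro s hs
        by_contra hc
        obtain ⟨y, hy, hye⟩ := intermediate_value_Icc' hs (hXc.mono (hsub s))
          (⟨not_lt.mp hc, hpos.le⟩ : (0 : ℝ) ∈ Icc (X s) (X s₀))
        exact hne (hsign s₀ h0 y hy.1 hye)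
      intro s t hs hst
      have := hXm (h0.trans_le hs : (0 : ℝ) < s) (h0.trans_le (hs.trans hst) : (0 : ℝ) < t) hst
      simp only [abs_of_pos (hn s hs), abs_of_pos (hn t (hs.trans hst))] at this
      exact this

end FunctionalDissipativity

end

/-! Write `X = logDer φ s` for s φ'(s)/φ(s). Where u ≠ 0 and s = |u|, the chain rule makes the h-th
term of the integrand a positive multiple of |u|²⟨ξ, Aξ⟩ + X⟨u, ξ⟩⟨u, Aξ⟩, with ξ = ∂_h u, A = 𝒜^h
and real inner products on ℂ^m. So everything rests on when the form |w|²⟨ξ, Aξ⟩ + X⟨w, ξ⟩⟨w, Aξ⟩ is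
nonnegative for all w and ξ. With a and b the extreme eigenvalues of A, this happens exactly when
(X/(X+2))²(a+b)² ≤ 4ab (`quadratic_nonneg_of_pinching`, `pinching_of_quadratic_nonneg`).

Up to sign X/(X+2) is Λ. Since |X| is nondecreasing and X > -1, the square of this ratio is
nondecreasing in s with limit Λ_∞² (`logDer_ratio_sq_le`, `tendsto_logDer_ratio_sq`). Hence the
inequality with Λ_∞ is the same as the inequality at every s.

Sufficiency is then pointwise: the integrand has nonnegative real part almost everywhere, the zeros
of u being treated through difference quotients (`inner_pderiv_nonneg_of_eq_zero`).

For necessity, fix z ≠ 0 and ξ, and take a test function equal to z near the support of η. Perturb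
it by (η/c) cos(c² x_h + θ) ξ: the values tend to z, while the derivative ∂_h has order c. Dividing
by c², adding the phases θ = 0 and θ = π/2, and letting c → ∞ leaves ∫ η² times the form at (z, ξ),
which is therefore nonnegative (`integral_sq_mul_nonneg`). Varying η gives the form's sign almost
everywhere, a countable dense set of vectors removes the dependence of the null set on (w, ξ), and s
→ ∞ produces Λ_∞. -/

noncomputable section

namespace FunctionalDissipativity

/-! ### Differential of the radial map -/

section Radial

variable {E : Type*} [NormedAddCommGroup E] [InnerProductSpace ℝ E]

/-- The radial map `z ↦ φ(|z|) z`. -/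
def radialMap (φ : ℝ → ℝ) (z : E) : E := φ ‖z‖ • z

theorem Admissible.contDiffAt {φ : ℝ → ℝ} (hφ : Admissible φ) {s : ℝ} (hs : 0 < s) :
    ContDiffAt ℝ 1 φ s :=
  hφ.contDiffOn.contDiffAt (Ioi_mem_nhds hs)

theorem Admissible.hasDerivAt {φ : ℝ → ℝ} (hφ : Admissible φ) {s : ℝ} (hs : 0 < s) :
    HasDerivAt φ (deriv φ s) s :=
  ((hφ.contDiffAt hs).differentiableAt one_ne_zero).hasDerivAt

theorem contDiffAt_radialMap {φ : ℝ → ℝ} (hφ : Admissible φ) {z : E} (hz : z ≠ 0) :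
    ContDiffAt ℝ 1 (radialMap φ) z :=
  ((hφ.contDiffAt (norm_pos_iff.mpr hz)).comp z (contDiffAt_norm ℝ hz)).smul contDiffAt_id

theorem hasFDerivAt_norm_of_ne {z : E} (hz : z ≠ 0) :
    HasFDerivAt (fun y : E => ‖y‖) (‖z‖⁻¹ • innerSL ℝ z) z := by
  have h := (hasStrictFDerivAt_norm_sq z).hasFDerivAt.sqrt (by simpa using hz)
  simp only [Real.sqrt_sq (norm_nonneg _)] at h
  convert h using 1
  ext y
  simp
  field_simp

theorem fderiv_radialMap {φ : ℝ → ℝ} (hφ : Admissible φ) {z : E} (hz : z ≠ 0) (ζ : E) :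
    fderiv ℝ (radialMap φ) z ζ = φ ‖z‖ • ζ + (deriv φ ‖z‖ / ‖z‖ * inner ℝ z ζ) • z := by
  have h1 := (hφ.hasDerivAt (norm_pos_iff.mpr hz)).comp_hasFDerivAt z (hasFDerivAt_norm_of_ne hz)
  have h2 : HasFDerivAt (radialMap φ) _ z := h1.smul (hasFDerivAt_id z)
  rw [h2.fderiv]
  simp [div_eq_mul_inv, mul_assoc]

/-- The logarithmic derivative `s φ'(s) / φ(s)`. -/
def logDer (φ : ℝ → ℝ) (s : ℝ) : ℝ := s * deriv φ s / φ s

/-- Factoring out the positive number φ/|z|² leaves an expression in which φ enters only through its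
logarithmic derivative. -/
theorem inner_fderiv_radialMap {φ : ℝ → ℝ} (hφ : Admissible φ) {z : E} (hz : z ≠ 0) (ζ y : E) :
    inner ℝ (fderiv ℝ (radialMap φ) z ζ) y =
      φ ‖z‖ / ‖z‖ ^ 2 *
        (‖z‖ ^ 2 * inner ℝ ζ y + logDer φ ‖z‖ * (inner ℝ z ζ * inner ℝ z y)) := by
  have h0 := norm_pos_iff.mpr hz
  have h1 := hφ.pos _ h0
  rw [fderiv_radialMap hφ hz, inner_add_left, real_inner_smul_left, real_inner_smul_left, logDer]
  field_simp

end Radial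

/-! ### Sharp nonnegativity criterion for the quadratic form -/

section QuadraticForm

variable {E : Type*} [NormedAddCommGroup E] [InnerProductSpace ℝ E]

/-- Here y stands for Tξ, and `hy` is (T - a)(b - T) ≥ 0 tested on ξ. With g = √(ab), polarization
gives 4g⟨w, ξ⟩⟨w, y⟩ = ⟨w, gξ + y⟩² - ⟨w, gξ - y⟩². Only the square that hurts for the given sign of
X is estimated: Cauchy–Schwarz and `hy` bound it by |w|²(a + b ± 2g)⟨ξ, y⟩. -/
theorem quadratic_nonneg_of_pinching {a b X : ℝ} (ha : 0 < a) (hb : 0 < b) (hX : -1 < X)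
    (hL : (X / (X + 2)) ^ 2 * (a + b) ^ 2 ≤ 4 * a * b) (w ξ y : E)
    (hy : ‖y‖ ^ 2 ≤ (a + b) * inner ℝ ξ y - a * b * ‖ξ‖ ^ 2) :
    0 ≤ ‖w‖ ^ 2 * inner ℝ ξ y + X * (inner ℝ w ξ * inner ℝ w y) := by
  obtain ⟨g, hg, hgg⟩ : ∃ g, 0 < g ∧ g ^ 2 = a * b :=
    ⟨√(a * b), Real.sqrt_pos.mpr (mul_pos ha hb), Real.sq_sqrt (mul_pos ha hb).le⟩
  have hX2 : 0 < X + 2 := by linarith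
  have hL' : |X| * (a + b) ≤ 2 * g * (X + 2) := by
    apply le_of_sq_le_sq _ (by positivity)
    have h1 : (X / (X + 2)) ^ 2 * (a + b) ^ 2 * (X + 2) ^ 2 ≤ 4 * a * b * (X + 2) ^ 2 := by gcongr
    have h2 : (X / (X + 2)) ^ 2 * (a + b) ^ 2 * (X + 2) ^ 2 = (|X| * (a + b)) ^ 2 := by
      rw [mul_pow, sq_abs]; field_simp
    rw [← h2]
    calc _ ≤ _ := h1
      _ = _ := by rw [mul_pow, mul_pow, hgg]; ring
  rw [← hgg] at hy
  set p := inner ℝ w ξ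
  set q := inner ℝ w y
  set t := inner ℝ ξ y
  have ht : 0 ≤ t := by
    by_contra h
    push Not at h
    nlinarith [sq_nonneg ‖y‖, sq_nonneg (g * ‖ξ‖), mul_neg_of_pos_of_neg (add_pos ha hb) h]
  have hadd : (g * p + q) ^ 2 ≤ ‖w‖ ^ 2 * (g ^ 2 * ‖ξ‖ ^ 2 + 2 * g * t + ‖y‖ ^ 2) := by
    have h1 : g * p + q = inner ℝ w (g • ξ + y) := by
      rw [inner_add_right, real_inner_smul_right]
    have h2 : g ^ 2 * ‖ξ‖ ^ 2 + 2 * g * t + ‖y‖ ^ 2 = ‖g • ξ + y‖ ^ 2 := by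
      rw [norm_add_sq_real, real_inner_smul_left, norm_smul, mul_pow, Real.norm_eq_abs, sq_abs]; ring
    rw [h1, h2, ← mul_pow, sq_le_sq, abs_of_nonneg (by positivity : 0 ≤ ‖w‖ * ‖g • ξ + y‖)]
    exact abs_real_inner_le_norm _ _
  have hsub : (g * p - q) ^ 2 ≤ ‖w‖ ^ 2 * (g ^ 2 * ‖ξ‖ ^ 2 - 2 * g * t + ‖y‖ ^ 2) := by
    have h1 : g * p - q = inner ℝ w (g • ξ - y) := by
      rw [inner_sub_right, real_inner_smul_right]
    have h2 : g ^ 2 * ‖ξ‖ ^ 2 - 2 * g * t + ‖y‖ ^ 2 = ‖g • ξ - y‖ ^ 2 := by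
      rw [norm_sub_sq_real, real_inner_smul_left, norm_smul, mul_pow, Real.norm_eq_abs, sq_abs]; ring
    rw [h1, h2, ← mul_pow, sq_le_sq, abs_of_nonneg (by positivity : 0 ≤ ‖w‖ * ‖g • ξ - y‖)]
    exact abs_real_inner_le_norm _ _
  have hw := sq_nonneg ‖w‖
  have hgoal : 0 ≤ 4 * g * (‖w‖ ^ 2 * t + X * (p * q)) := by
    rcases le_total 0 X with h | h
    · rw [abs_of_nonneg h] at hL'
      have h1 : (g * p - q) ^ 2 ≤ ‖w‖ ^ 2 * ((a + b - 2 * g) * t) :=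
        hsub.trans (mul_le_mul_of_nonneg_left (by linarith) hw)
      have h2 := mul_le_mul_of_nonneg_left h1 h
      have h3 : 0 ≤ (2 * g * (X + 2) - X * (a + b)) * (‖w‖ ^ 2 * t) :=
        mul_nonneg (by linarith) (by positivity)
      nlinarith [mul_nonneg h (sq_nonneg (g * p + q))]
    · rw [abs_of_nonpos h] at hL'
      have h1 : (g * p + q) ^ 2 ≤ ‖w‖ ^ 2 * ((a + b + 2 * g) * t) :=
        hadd.trans (mul_le_mul_of_nonneg_left (by linarith) hw)
      have h2 := mul_le_mul_of_nonneg_left h1 (neg_nonneg.mpr h)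
      have h3 : 0 ≤ (2 * g * (X + 2) + X * (a + b)) * (‖w‖ ^ 2 * t) :=
        mul_nonneg (by linarith) (by positivity)
      nlinarith [mul_nonneg (neg_nonneg.mpr h) (sq_nonneg (g * p - q))]
  exact nonneg_of_mul_nonneg_right hgoal (by positivity)

/-- The extremal vectors are w = f ± e and ξ = √b e + √a f; the two signs give the two halves of
|X|(a + b) ≤ 2√(ab)(X + 2). -/
theorem pinching_of_quadratic_nonneg {a b X : ℝ} (ha : 0 < a) (hab : a ≤ b) (hX : -1 < X)
    (T : E →ₗ[ℝ] E) {e f : E} (he : ‖e‖ = 1) (hf : ‖f‖ = 1) (hef : a ≠ b → inner ℝ e f = 0)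
    (hTe : T e = a • e) (hTf : T f = b • f)
    (hq : ∀ w ξ : E, 0 ≤ ‖w‖ ^ 2 * inner ℝ ξ (T ξ) + X * (inner ℝ w ξ * inner ℝ w (T ξ))) :
    (X / (X + 2)) ^ 2 * (a + b) ^ 2 ≤ 4 * a * b := by
  have hb : 0 < b := ha.trans_le hab
  have hX2 : 0 < X + 2 := by linarith
  suffices h : (X * (a + b)) ^ 2 ≤ (4 * a * b) * (X + 2) ^ 2 by
    rw [div_pow, div_mul_eq_mul_div, div_le_iff₀ (by positivity), ← mul_pow]
    exact h
  -- If a = b, orthogonality is not available, but the claim reduces to X² ≤ (X + 2)², which follows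
  -- from X > -1.
  rcases eq_or_ne a b with rfl | hne
  · have : 0 ≤ 4 * a ^ 2 * (4 * (X + 1)) := by
      have : 0 < X + 1 := by linarith
      positivity
    nlinarith
  replace hef := hef hne
  have hfe : inner ℝ f e = 0 := by rw [real_inner_comm]; exact hef
  obtain ⟨P, hP, rfl⟩ : ∃ P, 0 < P ∧ P ^ 2 = a := ⟨√a, Real.sqrt_pos.mpr ha, Real.sq_sqrt ha.le⟩
  obtain ⟨Q, hQ, rfl⟩ : ∃ Q, 0 < Q ∧ Q ^ 2 = b := ⟨√b, Real.sqrt_pos.mpr hb, Real.sq_sqrt hb.le⟩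
  have hee : inner ℝ e e = (1 : ℝ) := by rw [real_inner_self_eq_norm_sq, he]; norm_num
  have hff : inner ℝ f f = (1 : ℝ) := by rw [real_inner_self_eq_norm_sq, hf]; norm_num
  have key : ∀ σ : ℝ, σ ^ 2 = 1 →
      0 ≤ P * Q * (4 * (P * Q) + σ * X * (P + σ * Q) ^ 2) := by
    intro σ hσ
    have h := hq (σ • e + f) (Q • e + P • f)
    rw [← real_inner_self_eq_norm_sq] at h
    simp only [map_add, map_smul, hTe, hTf, inner_add_left, inner_add_right, real_inner_smul_left,
      real_inner_smul_right, hee, hff, hef, hfe] at h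
    refine h.trans_eq ?_
    linear_combination (2 * P ^ 2 * Q ^ 2 - X * (P * Q) * (P * Q + σ * Q ^ 2)) * hσ
  have hPQ : 0 < P * Q := mul_pos hP hQ
  have key' : ∀ σ : ℝ, σ ^ 2 = 1 → 0 ≤ 4 * (P * Q) + σ * X * (P + σ * Q) ^ 2 := fun σ hσ =>
    nonneg_of_mul_nonneg_right (key σ hσ) hPQ
  have h1 := key' 1 (by norm_num)
  have h2 := key' (-1) (by norm_num)
  have h3 : |X * (P ^ 2 + Q ^ 2)| ≤ 2 * (P * Q) * (X + 2) := by
    rw [abs_le]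
    constructor <;> nlinarith
  have h4 := pow_le_pow_left₀ (abs_nonneg _) h3 2
  rw [sq_abs] at h4
  calc _ ≤ _ := h4
    _ = _ := by ring

end QuadraticForm

/-! ### Extreme eigenvalues of a real symmetric matrix -/

section Eigenvalues

variable {m : ℕ} {M : Matrix (Fin m) (Fin m) ℝ}

theorem setOf_hasEigenvalue (hM : M.IsHermitian) :
    {μ : ℝ | Module.End.HasEigenvalue (Matrix.toLin' M) μ} = range hM.eigenvalues := by
  ext μ
  rw [mem_ofPred_eq, Module.End.hasEigenvalue_iff_mem_spectrum, Matrix.spectrum_toLin',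
    hM.spectrum_real_eq_range_eigenvalues]

theorem minEigenvalue_le (hM : M.IsHermitian) (i : Fin m) :
    minEigenvalue M ≤ hM.eigenvalues i := by
  rw [minEigenvalue, setOf_hasEigenvalue hM]
  exact csInf_le (finite_range _).bddBelow (mem_range_self i)

theorem le_maxEigenvalue (hM : M.IsHermitian) (i : Fin m) :
    hM.eigenvalues i ≤ maxEigenvalue M := by
  rw [maxEigenvalue, setOf_hasEigenvalue hM]
  exact le_csSup (finite_range _).bddAbove (mem_range_self i)

theorem exists_eigenvalues_eq_min (hM : M.IsHermitian) (hm : 1 ≤ m) :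
    ∃ i, hM.eigenvalues i = minEigenvalue M := by
  have : Nonempty (Fin m) := ⟨⟨0, hm⟩⟩
  rw [minEigenvalue, setOf_hasEigenvalue hM]
  exact (range_nonempty _).csInf_mem (finite_range _)

theorem exists_eigenvalues_eq_max (hM : M.IsHermitian) (hm : 1 ≤ m) :
    ∃ i, hM.eigenvalues i = maxEigenvalue M := by
  have : Nonempty (Fin m) := ⟨⟨0, hm⟩⟩
  rw [maxEigenvalue, setOf_hasEigenvalue hM]
  exact (range_nonempty _).csSup_mem (finite_range _)

theorem minEigenvalue_le_maxEigenvalue (hM : M.IsHermitian) (hm : 1 ≤ m) :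
    minEigenvalue M ≤ maxEigenvalue M :=
  (minEigenvalue_le hM ⟨0, hm⟩).trans (le_maxEigenvalue hM ⟨0, hm⟩)

theorem minEigenvalue_pos (hM : M.IsHermitian) (hm : 1 ≤ m)
    (hpos : ∀ ξ : Fin m → ℝ, ξ ≠ 0 → 0 < dotProduct (M.mulVec ξ) ξ) : 0 < minEigenvalue M := by
  obtain ⟨i, hi⟩ := exists_eigenvalues_eq_min hM hm
  rw [← hi]
  have hne : WithLp.ofLp (hM.eigenvectorBasis i) ≠ 0 :=
    (WithLp.ofLp_eq_zero 2).ne.2 (hM.eigenvectorBasis.orthonormal.ne_zero i)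
  have h := hpos _ hne
  rw [hM.mulVec_eigenvectorBasis, smul_dotProduct, smul_eq_mul] at h
  exact pos_of_mul_pos_left h (dotProduct_self_star_nonneg _)

/-- This is (M - a)(b - M) ≥ 0 for the extreme eigenvalues a, b; in an eigenbasis each summand is
(λᵢ - a)(b - λᵢ) times a square. -/
theorem mulVec_dotProduct_le (hM : M.IsHermitian) (x : Fin m → ℝ) :
    dotProduct (M.mulVec x) (M.mulVec x) ≤
      (minEigenvalue M + maxEigenvalue M) * dotProduct x (M.mulVec x) -
        minEigenvalue M * maxEigenvalue M * dotProduct x x := by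
  set B := hM.eigenvectorBasis
  have hin : ∀ y z : Fin m → ℝ, dotProduct y z =
      ∑ i, inner ℝ (WithLp.toLp 2 y) (B i) * inner ℝ (B i) (WithLp.toLp 2 z) := by
    intro y z
    rw [B.sum_inner_mul_inner, EuclideanSpace.inner_eq_star_dotProduct, dotProduct_comm]
    simp
  have hMx : ∀ i, inner ℝ (B i) (WithLp.toLp 2 (M.mulVec x)) =
      hM.eigenvalues i * inner ℝ (B i) (WithLp.toLp 2 x) := by
    intro i
    have hT : M.IsSymm := by simpa using hM
    simp only [EuclideanSpace.inner_eq_star_dotProduct, star_trivial]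
    rw [← smul_eq_mul, ← dotProduct_smul, ← hM.mulVec_eigenvectorBasis, dotProduct_comm,
      Matrix.dotProduct_mulVec, ← Matrix.mulVec_transpose, hT.eq, dotProduct_comm]
  have hMx' : ∀ i, inner ℝ (WithLp.toLp 2 (M.mulVec x)) (B i) =
      hM.eigenvalues i * inner ℝ (B i) (WithLp.toLp 2 x) := fun i => by
    rw [real_inner_comm, hMx]
  have hx' : ∀ i, inner ℝ (WithLp.toLp 2 x) (B i) = inner ℝ (B i) (WithLp.toLp 2 x) :=
    fun i => real_inner_comm _ _
  simp only [hin, hMx, hMx', hx']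
  rw [Finset.mul_sum, Finset.mul_sum, ← Finset.sum_sub_distrib]
  refine Finset.sum_le_sum fun i _ => ?_
  have h1 := minEigenvalue_le hM i
  have h2 := le_maxEigenvalue hM i
  nlinarith [mul_nonneg (mul_nonneg (sub_nonneg.mpr h1) (sub_nonneg.mpr h2))
    (sq_nonneg (inner ℝ (B i) (WithLp.toLp 2 x)))]

theorem trace_eq_min_add_max {M : Matrix (Fin 2) (Fin 2) ℝ} (hM : M.IsHermitian) :
    M.trace = minEigenvalue M + maxEigenvalue M ∧
      M.det = minEigenvalue M * maxEigenvalue M := by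
  have h1 : M.trace = hM.eigenvalues 0 + hM.eigenvalues 1 := by
    rw [hM.trace_eq_sum_eigenvalues]; simp
  have h2 : M.det = hM.eigenvalues 0 * hM.eigenvalues 1 := by
    rw [hM.det_eq_prod_eigenvalues]; simp
  have hr : range hM.eigenvalues = {hM.eigenvalues 0, hM.eigenvalues 1} := by
    ext y; simp [Fin.exists_fin_two, eq_comm]
  rw [minEigenvalue, maxEigenvalue, setOf_hasEigenvalue hM, hr, csInf_pair, csSup_pair, h1, h2]
  exact ⟨(min_add_max _ _).symm, (min_mul_max _ _).symm⟩

end Eigenvalues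

/-! ### Real matrices acting on complex vectors -/

section MatrixAction

variable {m : ℕ}

/-- The action of a real matrix on `ℂ^m`. -/
def realAct (M : Matrix (Fin m) (Fin m) ℝ) :
    EuclideanSpace ℂ (Fin m) →ₗ[ℝ] EuclideanSpace ℂ (Fin m) where
  toFun z := WithLp.toLp 2 ((M.map Complex.ofReal).mulVec (WithLp.ofLp z))
  map_add' x y := by simp [Matrix.mulVec_add]
  map_smul' c x := by simp [Matrix.mulVec_smul]

theorem realAct_apply (M : Matrix (Fin m) (Fin m) ℝ) (z : EuclideanSpace ℂ (Fin m)) :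
    realAct M z = WithLp.toLp 2 ((M.map Complex.ofReal).mulVec (WithLp.ofLp z)) := rfl

theorem realAct_apply_apply (M : Matrix (Fin m) (Fin m) ℝ) (z : EuclideanSpace ℂ (Fin m))
    (i : Fin m) : realAct M z i = ∑ j, (M i j : ℂ) * z j := rfl

/-- Coordinatewise real parts. -/
def rePart (z : EuclideanSpace ℂ (Fin m)) : Fin m → ℝ := fun i => (z i).re

/-- Coordinatewise imaginary parts. -/
def imPart (z : EuclideanSpace ℂ (Fin m)) : Fin m → ℝ := fun i => (z i).im

theorem re_inner_eq_inner_real (z w : EuclideanSpace ℂ (Fin m)) :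
    (inner ℂ z w).re = inner ℝ z w := by
  simp only [PiLp.inner_apply, Complex.re_sum]
  rfl

theorem inner_real_eq (z w : EuclideanSpace ℂ (Fin m)) :
    inner ℝ z w = dotProduct (rePart z) (rePart w) + dotProduct (imPart z) (imPart w) := by
  rw [← re_inner_eq_inner_real]
  simp only [PiLp.inner_apply, Complex.re_sum, dotProduct, rePart, imPart,
    ← Finset.sum_add_distrib]
  refine Finset.sum_congr rfl fun i _ => ?_
  simp
  ring

theorem rePart_realAct (M : Matrix (Fin m) (Fin m) ℝ) (z : EuclideanSpace ℂ (Fin m)) :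
    rePart (realAct M z) = M.mulVec (rePart z) := by
  ext i
  simp [rePart, realAct_apply_apply, Matrix.mulVec, dotProduct]

theorem imPart_realAct (M : Matrix (Fin m) (Fin m) ℝ) (z : EuclideanSpace ℂ (Fin m)) :
    imPart (realAct M z) = M.mulVec (imPart z) := by
  ext i
  simp [imPart, realAct_apply_apply, Matrix.mulVec, dotProduct]

theorem norm_realAct_sq_le {M : Matrix (Fin m) (Fin m) ℝ} (hM : M.IsHermitian)
    (z : EuclideanSpace ℂ (Fin m)) :
    ‖realAct M z‖ ^ 2 ≤ (minEigenvalue M + maxEigenvalue M) * inner ℝ z (realAct M z) -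
      minEigenvalue M * maxEigenvalue M * ‖z‖ ^ 2 := by
  rw [← real_inner_self_eq_norm_sq, ← real_inner_self_eq_norm_sq]
  simp only [inner_real_eq, rePart_realAct, imPart_realAct]
  linarith [mulVec_dotProduct_le hM (rePart z), mulVec_dotProduct_le hM (imPart z)]

theorem inner_realAct_pos {M : Matrix (Fin m) (Fin m) ℝ}
    (hpos : ∀ ξ : Fin m → ℝ, ξ ≠ 0 → 0 < dotProduct (M.mulVec ξ) ξ)
    {z : EuclideanSpace ℂ (Fin m)} (hz : z ≠ 0) : 0 < inner ℝ z (realAct M z) := by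
  have hnn : ∀ ξ : Fin m → ℝ, 0 ≤ dotProduct ξ (M.mulVec ξ) := by
    intro ξ
    rw [dotProduct_comm]
    rcases eq_or_ne ξ 0 with rfl | h
    · simp
    · exact (hpos ξ h).le
  rw [inner_real_eq, rePart_realAct, imPart_realAct]
  by_cases hre : rePart z = 0
  · have him : imPart z ≠ 0 := by
      intro him
      apply hz
      ext i
      exact Complex.ext (congrFun hre i) (congrFun him i)
    have := hpos _ him
    rw [dotProduct_comm] at this
    linarith [hnn (rePart z)]
  · have := hpos _ hre
    rw [dotProduct_comm] at this
    linarith [hnn (imPart z)]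

/-- Real eigenvectors, read as complex ones, suffice. The indices may coincide, as they must when m
= 1, so orthogonality is claimed only for i ≠ j. -/
theorem exists_unit_eigenvector {M : Matrix (Fin m) (Fin m) ℝ} (hM : M.IsHermitian) (i j : Fin m) :
    ∃ e f : EuclideanSpace ℂ (Fin m), ‖e‖ = 1 ∧ ‖f‖ = 1 ∧ (i ≠ j → inner ℝ e f = 0) ∧
      realAct M e = hM.eigenvalues i • e ∧ realAct M f = hM.eigenvalues j • f := by
  set B := hM.eigenvectorBasis
  let c : EuclideanSpace ℝ (Fin m) → EuclideanSpace ℂ (Fin m) :=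
    fun x => WithLp.toLp 2 fun k => ((x k : ℝ) : ℂ)
  have hre : ∀ x, rePart (c x) = WithLp.ofLp x := fun x => by ext k; simp [rePart, c]
  have him : ∀ x, imPart (c x) = 0 := fun x => by ext k; simp [imPart, c]
  have hin : ∀ x y, inner ℝ (c x) (c y) = inner ℝ x y := fun x y => by
    rw [inner_real_eq, hre, hre, him, EuclideanSpace.inner_eq_star_dotProduct, dotProduct_comm]
    simp
  have hn : ∀ k, ‖c (B k)‖ = 1 := fun k => by
    have : ‖c (B k)‖ ^ 2 = 1 := by
      rw [← real_inner_self_eq_norm_sq, hin, real_inner_self_eq_norm_sq, B.norm_eq_one, one_pow]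
    exact (pow_eq_one_iff_of_nonneg (norm_nonneg _) two_ne_zero).mp this
  have hact : ∀ k, realAct M (c (B k)) = hM.eigenvalues k • c (B k) := fun k => by
    have h := hM.mulVec_eigenvectorBasis k
    ext l
    have hl := congrFun h l
    apply Complex.ext
    · change rePart (realAct M (c (B k))) l = _
      rw [rePart_realAct, hre]
      simpa [c] using hl
    · change imPart (realAct M (c (B k))) l = _
      rw [imPart_realAct, him]
      simp [c]
  exact ⟨c (B i), c (B j), hn i, hn j, fun h => by rw [hin]; exact B.orthonormal.2 h,
    hact i, hact j⟩

theorem norm_realAct_le (M : Matrix (Fin m) (Fin m) ℝ) (z : EuclideanSpace ℂ (Fin m)) :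
    ‖realAct M z‖ ≤ (∑ i, ∑ j, |M i j|) * ‖z‖ := by
  have h1 : realAct M z = ∑ i, EuclideanSpace.single i (realAct M z i) := by
    ext i
    simp
  rw [h1, Finset.sum_mul]
  refine (norm_sum_le _ _).trans (Finset.sum_le_sum fun i _ => ?_)
  rw [PiLp.norm_single, realAct_apply_apply, Finset.sum_mul]
  refine (norm_sum_le _ _).trans (Finset.sum_le_sum fun j _ => ?_)
  rw [norm_mul, Complex.norm_real, Real.norm_eq_abs]
  exact mul_le_mul_of_nonneg_left (PiLp.norm_apply_le z j) (abs_nonneg _)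

end MatrixAction

/-! ### Monotonicity of Λ² and its limit -/

section Lambda

variable {φ : ℝ → ℝ}

theorem neg_one_lt_logDer (hφ : Admissible φ) {s : ℝ} (hs : 0 < s) : -1 < logDer φ s := by
  have h1 := hφ.deriv_pos s hs
  have h2 : deriv (fun t => t * φ t) s = φ s + s * deriv φ s := by
    have := ((hasDerivAt_id s).mul (hφ.hasDerivAt hs)).deriv
    simpa [Pi.mul_def] using this
  rw [h2] at h1
  rw [logDer, lt_div_iff₀ (hφ.pos s hs)]
  linarith

theorem Lam_eq_logDer (hφ : Admissible φ) {s : ℝ} (hs : 0 < s) :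
    Lam φ (s * √(φ s)) = -(logDer φ s / (logDer φ s + 2)) := by
  have h0 := hφ.pos s hs
  rw [Lam_apply hφ hs, logDer]
  field_simp

theorem continuousOn_logDer (hφ : Admissible φ) : ContinuousOn (logDer φ) (Ioi 0) :=
  (continuousOn_id.mul (hφ.contDiffOn.continuousOn_deriv_of_isOpen isOpen_Ioi le_rfl)).div
    hφ.contDiffOn.continuousOn (fun s hs => (hφ.pos s hs).ne')

theorem abs_logDer_le (hφ : Admissible φ) {s t : ℝ} (hs : 0 < s) (hst : s ≤ t) :
    |logDer φ s| ≤ |logDer φ t| :=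
  hφ.monotone_abs hs (hs.trans_le hst : (0 : ℝ) < t) hst

/-- Monotonicity of |X| alone is not enough, because x/(x + 2) is not odd. But once X is nonzero it
stays nonzero, so by continuity it keeps its sign, and x ↦ x/(x + 2) is increasing on (-1, ∞). -/
theorem logDer_ratio_sq_le (hφ : Admissible φ) {s t : ℝ} (hs : 0 < s) (hst : s ≤ t) :
    (logDer φ s / (logDer φ s + 2)) ^ 2 ≤ (logDer φ t / (logDer φ t + 2)) ^ 2 := by
  have ht := hs.trans_le hst
  have hXs := neg_one_lt_logDer hφ hs
  have hXt := neg_one_lt_logDer hφ ht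
  have habs := abs_logDer_le hφ hs hst
  rw [sq_le_sq, abs_div, abs_div, abs_of_pos (by linarith : 0 < logDer φ s + 2),
    abs_of_pos (by linarith : 0 < logDer φ t + 2)]
  by_cases h0 : logDer φ s = 0
  · rw [h0, abs_zero, zero_div]
    exact div_nonneg (abs_nonneg _) (by linarith)
  have hne : ∀ y ∈ Icc s t, logDer φ y ≠ 0 := by
    intro y hy h
    have := abs_logDer_le hφ hs hy.1
    rw [h, abs_zero] at this
    exact h0 (abs_nonpos_iff.mp this)
  have hc : ContinuousOn (logDer φ) (Icc s t) :=
    (continuousOn_logDer hφ).mono fun y hy => hs.trans_le hy.1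
  rw [div_le_div_iff₀ (by linarith) (by linarith)]
  rcases lt_or_gt_of_ne h0 with hneg | hpos
  · have h1 : logDer φ t < 0 := by
      by_contra hcon
      obtain ⟨y, hy, hye⟩ := intermediate_value_Icc hst hc ⟨hneg.le, not_lt.mp hcon⟩
      exact hne y hy hye
    rw [abs_of_neg hneg, abs_of_neg h1] at *
    nlinarith
  · have h1 : 0 < logDer φ t := by
      by_contra hcon
      obtain ⟨y, hy, hye⟩ := intermediate_value_Icc' hst hc ⟨not_lt.mp hcon, hpos.le⟩
      exact hne y hy hye
    rw [abs_of_pos hpos, abs_of_pos h1] at *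
    nlinarith

theorem tendsto_mul_sqrt_atTop (hφ : Admissible φ) :
    Tendsto (fun s => s * √(φ s)) atTop atTop := by
  rw [tendsto_atTop]
  intro b
  obtain ⟨s₀, h0, he⟩ := hφ.surjOn (lt_max_of_lt_right one_pos : 0 < max b 1)
  filter_upwards [eventually_ge_atTop s₀] with s hs
  have h1 := hφ.strictMonoOn.monotoneOn h0 (lt_of_lt_of_le h0 hs : (0 : ℝ) < s) hs
  simp only at he h1
  rw [he] at h1
  exact (le_max_left _ _).trans h1

theorem tendsto_logDer_ratio_sq (hφ : Admissible φ) :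
    Tendsto (fun s => (logDer φ s / (logDer φ s + 2)) ^ 2) atTop (𝓝 (LamInf φ ^ 2)) := by
  refine (((tendsto_Lam hφ).comp (tendsto_mul_sqrt_atTop hφ)).pow 2).congr' ?_
  filter_upwards [eventually_gt_atTop 0] with s hs
  simp only [Function.comp_apply]
  rw [Lam_eq_logDer hφ hs, neg_sq]

theorem logDer_ratio_sq_le_LamInf_sq (hφ : Admissible φ) {s : ℝ} (hs : 0 < s) :
    (logDer φ s / (logDer φ s + 2)) ^ 2 ≤ LamInf φ ^ 2 := by
  refine ge_of_tendsto (tendsto_logDer_ratio_sq hφ) ?_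
  filter_upwards [eventually_ge_atTop s] with t ht using logDer_ratio_sq_le hφ hs ht

end Lambda

/-! ### Sufficiency: pointwise nonnegativity of the integrand -/

section Sufficiency

variable {n m : ℕ} {φ : ℝ → ℝ}

theorem phiMul_eq_comp (φ : ℝ → ℝ) (u : EuclideanSpace ℝ (Fin n) → EuclideanSpace ℂ (Fin m)) :
    phiMul φ u = radialMap φ ∘ u := rfl

theorem diagCoeff_integrand (A : Fin n → EuclideanSpace ℝ (Fin n) → Matrix (Fin m) (Fin m) ℝ)
    (u v : EuclideanSpace ℝ (Fin n) → EuclideanSpace ℂ (Fin m)) (x : EuclideanSpace ℝ (Fin n)) :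
    ∑ h, ∑ k, inner ℂ (pderiv h v x)
        (WithLp.toLp 2 ((diagCoeff A h k x).mulVec (WithLp.ofLp (pderiv k u x)))) =
      ∑ h, inner ℂ (pderiv h v x) (realAct (A h x) (pderiv h u x)) := by
  refine Finset.sum_congr rfl fun h _ => ?_
  rw [Finset.sum_eq_single h]
  · simp [diagCoeff, realAct_apply]
  · intro k _ hk
    simp [diagCoeff, hk.symm]
  · simp

theorem hasDerivAt_line {E F : Type*} [NormedAddCommGroup E] [NormedSpace ℝ E]
    [NormedAddCommGroup F] [NormedSpace ℝ F] {u : E → F} {x : E} (hu : DifferentiableAt ℝ u x)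
    (e : E) : HasDerivAt (fun t : ℝ => u (x + t • e)) (fderiv ℝ u x e) 0 := by
  have h1 : HasDerivAt (fun t : ℝ => x + t • e) e 0 := by
    simpa using ((hasDerivAt_id (0 : ℝ)).smul_const e).const_add x
  have h2 : HasFDerivAt u (fderiv ℝ u x) (x + (0 : ℝ) • e) := by simpa using hu.hasFDerivAt
  exact h2.comp_hasDerivAt 0 h1

/-- The radial map need not be differentiable at 0, so the chain rule is unavailable. Instead, the
difference quotients of φ(|u|)u are those of u multiplied by φ(|u|) > 0 (or are zero), and those of
u eventually have positive product with A ∂_h u. -/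
theorem inner_pderiv_nonneg_of_eq_zero (hφ : Admissible φ)
    {u : EuclideanSpace ℝ (Fin n) → EuclideanSpace ℂ (Fin m)} {x : EuclideanSpace ℝ (Fin n)}
    (hu : DifferentiableAt ℝ u x) (hv : DifferentiableAt ℝ (phiMul φ u) x) (hx : u x = 0)
    {M : Matrix (Fin m) (Fin m) ℝ}
    (hpos : ∀ ξ : Fin m → ℝ, ξ ≠ 0 → 0 < dotProduct (M.mulVec ξ) ξ) (h : Fin n) :
    0 ≤ inner ℝ (pderiv h (phiMul φ u) x) (realAct M (pderiv h u x)) := by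
  set e : EuclideanSpace ℝ (Fin n) := EuclideanSpace.single h 1
  by_cases h0 : pderiv h u x = 0
  · simp [h0]
  have h1 := (hasDerivAt_line hu e).tendsto_slope_zero_right
  have h2 := (hasDerivAt_line hv e).tendsto_slope_zero_right
  set y := realAct M (pderiv h u x)
  have h3 : Tendsto (fun t : ℝ => inner ℝ (t⁻¹ • (u (x + (0 + t) • e) - u (x + (0 : ℝ) • e))) y)
      (𝓝[>] 0) (𝓝 (inner ℝ (pderiv h u x) y)) := h1.inner tendsto_const_nhds
  have h4 : Tendsto (fun t : ℝ => inner ℝ (t⁻¹ • (phiMul φ u (x + (0 + t) • e) -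
      phiMul φ u (x + (0 : ℝ) • e))) y)
      (𝓝[>] 0) (𝓝 (inner ℝ (pderiv h (phiMul φ u) x) y)) := h2.inner tendsto_const_nhds
  refine ge_of_tendsto h4 ?_
  filter_upwards [h3.eventually (lt_mem_nhds (inner_realAct_pos hpos h0))] with t ht
  simp only [zero_smul, add_zero, hx, zero_add, sub_zero, phiMul, smul_zero] at ht ⊢
  by_cases hz : u (x + t • e) = 0
  · simp [hz]
  · rw [smul_comm, real_inner_smul_left]
    exact mul_nonneg (hφ.pos _ (norm_pos_iff.mpr hz)).le ht.le

theorem inner_pderiv_nonneg (hm : 1 ≤ m) (hφ : Admissible φ)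
    {u : EuclideanSpace ℝ (Fin n) → EuclideanSpace ℂ (Fin m)} {x : EuclideanSpace ℝ (Fin n)}
    (hu : DifferentiableAt ℝ u x) (hv : DifferentiableAt ℝ (phiMul φ u) x)
    {M : Matrix (Fin m) (Fin m) ℝ} (hM : M.IsSymm)
    (hpos : ∀ ξ : Fin m → ℝ, ξ ≠ 0 → 0 < dotProduct (M.mulVec ξ) ξ)
    (hL : LamInf φ ^ 2 * (minEigenvalue M + maxEigenvalue M) ^ 2 ≤
      4 * minEigenvalue M * maxEigenvalue M) (h : Fin n) :
    0 ≤ inner ℝ (pderiv h (phiMul φ u) x) (realAct M (pderiv h u x)) := by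
  by_cases hx : u x = 0
  · exact inner_pderiv_nonneg_of_eq_zero hφ hu hv hx hpos h
  have hM' : M.IsHermitian := by simpa using hM
  have ha := minEigenvalue_pos hM' hm hpos
  have hb := ha.trans_le (minEigenvalue_le_maxEigenvalue hM' hm)
  have hs := norm_pos_iff.mpr hx
  have hchain : pderiv h (phiMul φ u) x = fderiv ℝ (radialMap φ) (u x) (pderiv h u x) := by
    rw [pderiv, phiMul_eq_comp,
      fderiv_comp x ((contDiffAt_radialMap hφ hx).differentiableAt one_ne_zero) hu]
    rfl
  rw [hchain, inner_fderiv_radialMap hφ hx]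
  refine mul_nonneg (div_nonneg (hφ.pos _ hs).le (sq_nonneg _)) ?_
  refine quadratic_nonneg_of_pinching ha hb (neg_one_lt_logDer hφ hs) ?_ _ _ _
    (norm_realAct_sq_le hM' _)
  exact (mul_le_mul_of_nonneg_right (logDer_ratio_sq_le_LamInf_sq hφ hs) (sq_nonneg _)).trans hL

theorem re_integral_nonneg {α : Type*} [MeasurableSpace α] {μ : Measure α} {f : α → ℂ}
    (hf : ∀ᵐ x ∂μ, 0 ≤ (f x).re) : 0 ≤ (∫ x, f x ∂μ).re := by
  by_cases hi : Integrable f μ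
  · have : (∫ x, f x ∂μ).re = ∫ x, (f x).re ∂μ := (integral_re hi).symm
    rw [this]
    exact integral_nonneg_of_ae hf
  -- A non-integrable function has integral 0 by convention, so no integrability is needed.
  · rw [integral_undef hi, Complex.zero_re]

theorem lPhiDissipative_of_pinching (hm : 1 ≤ m) (hφ : Admissible φ)
    {Ω : Set (EuclideanSpace ℝ (Fin n))}
    {A : Fin n → EuclideanSpace ℝ (Fin n) → Matrix (Fin m) (Fin m) ℝ}
    (hA_symm : ∀ h, ∀ᵐ x ∂(volume.restrict Ω), (A h x).IsSymm)
    (hA_pos : ∀ h, ∀ᵐ x ∂(volume.restrict Ω),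
      ∀ ξ : Fin m → ℝ, ξ ≠ 0 → 0 < dotProduct ((A h x).mulVec ξ) ξ)
    (hL : ∀ h, ∀ᵐ x ∂(volume.restrict Ω),
      LamInf φ ^ 2 * (minEigenvalue (A h x) + maxEigenvalue (A h x)) ^ 2 ≤
        4 * minEigenvalue (A h x) * maxEigenvalue (A h x)) :
    LPhiDissipative φ Ω (diagCoeff A) := by
  intro u hu hv
  apply re_integral_nonneg
  filter_upwards [ae_all_iff.mpr hA_symm, ae_all_iff.mpr hA_pos, ae_all_iff.mpr hL] with x h1 h2 h3
  rw [diagCoeff_integrand, Complex.re_sum]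
  refine Finset.sum_nonneg fun h _ => ?_
  rw [re_inner_eq_inner_real]
  exact inner_pderiv_nonneg hm hφ (hu.1.differentiable one_ne_zero x)
    (hv.1.differentiable one_ne_zero x) (h1 h) (h2 h) (h3 h) h

end Sufficiency

/-! ### Admissible test functions that are constant on a compact set -/

section Cutoff

variable {φ : ℝ → ℝ}

theorem Admissible.strictMonoOn_mul (hφ : Admissible φ) :
    StrictMonoOn (fun s => s * φ s) (Ioi 0) := by
  apply strictMonoOn_of_deriv_pos (convex_Ioi 0)
  · exact continuousOn_id.mul hφ.contDiffOn.continuousOn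
  · intro s hs
    rw [interior_Ioi] at hs
    exact hφ.deriv_pos s hs

/-- An increasing function whose range is all of (0, ∞) has infimum 0, attained as a limit at the
left end. -/
theorem Admissible.tendsto_mul_zero (hφ : Admissible φ) :
    Tendsto (fun s => s * φ s) (𝓝[≥] 0) (𝓝 0) := by
  rw [Metric.tendsto_nhds]
  intro ε hε
  obtain ⟨t, ht, hte⟩ : ε ∈ (fun s => s * φ s) '' Ioi 0 := by
    rw [hφ.range_eq]; exact hε
  filter_upwards [Ico_mem_nhdsGE (ht : (0 : ℝ) < t)] with s hs
  rw [Real.dist_eq, sub_zero]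
  rcases eq_or_lt_of_le hs.1 with rfl | h0
  · simpa using hε
  · have h1 := hφ.strictMonoOn_mul h0 ht hs.2
    simp only [hte] at h1
    rwa [abs_of_pos (mul_pos h0 (hφ.pos s h0))]

/-- Composing `t ↦ t φ(t)` with a high even power gives a `C¹` function on the line. -/
theorem exists_even_pow_contDiff (hφ : Admissible φ) {s : ℝ} (hs : 0 < s) :
    ∃ p : ℕ, p ≠ 0 ∧ Even p ∧ ContDiff ℝ 1 (fun τ : ℝ => (s * τ ^ p) * φ (s * τ ^ p)) := by
  obtain ⟨s₀, hs₀, ⟨C₁, C₂, r, hC₁, hC₂, hr, hgr, -⟩, -⟩ := hφ.growth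
  obtain ⟨N, hN⟩ := exists_nat_ge (2 / (r + 1))
  have hκ : 0 < r + 1 := by linarith
  -- The condition p(r + 1) ≥ 2 makes the composite O(τ²) with derivative O(|τ|) at 0; evenness
  -- keeps s τ^p positive on both sides of 0.
  obtain ⟨p, hp2, hpe, hpκ⟩ : ∃ p : ℕ, 2 ≤ p ∧ Even p ∧ 2 ≤ (p : ℝ) * (r + 1) := by
    refine ⟨2 * (N + 1), by omega, even_two_mul _, ?_⟩
    rw [div_le_iff₀ hκ] at hN
    push_cast
    nlinarith [N.cast_nonneg (α := ℝ)]
  set F : ℝ → ℝ := fun t => t * φ t with hF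
  have hp0 : p ≠ 0 := by omega
  have hp1 : p - 1 ≠ 0 := by omega
  have hpos : ∀ τ : ℝ, τ ≠ 0 → 0 < s * τ ^ p := fun τ hτ => mul_pos hs (hpe.pow_pos hτ)
  have hFd : ∀ t, 0 < t → HasDerivAt F (deriv F t) t := fun t ht =>
    (differentiableAt_id.mul (hφ.hasDerivAt ht).differentiableAt).hasDerivAt
  have hFc : ContinuousOn (deriv F) (Ioi 0) :=
    (contDiffOn_id.mul hφ.contDiffOn).continuousOn_deriv_of_isOpen isOpen_Ioi le_rfl
  set g : ℝ → ℝ := fun τ => deriv F (s * τ ^ p) * (s * (p * τ ^ (p - 1))) with hg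
  have hHd : ∀ τ ≠ 0, HasDerivAt (fun τ : ℝ => F (s * τ ^ p)) (g τ) τ := fun τ hτ =>
    HasDerivAt.comp (h := fun τ : ℝ => s * τ ^ p) τ (hFd _ (hpos τ hτ))
      ((hasDerivAt_pow p τ).const_mul s)
  have hpow0 : Tendsto (fun τ : ℝ => s * τ ^ p) (𝓝 0) (𝓝[≥] 0) := by
    refine tendsto_nhdsWithin_iff.mpr ⟨?_, Eventually.of_forall fun τ =>
      mul_nonneg hs.le (hpe.pow_nonneg τ)⟩
    have : Continuous fun τ : ℝ => s * τ ^ p := by fun_prop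
    simpa [hp0] using this.tendsto 0
  have hHc : ContinuousAt (fun τ : ℝ => F (s * τ ^ p)) 0 := by
    have h0 : F (s * 0 ^ p) = 0 := by simp [hF, hp0]
    rw [ContinuousAt, h0]
    exact hφ.tendsto_mul_zero.comp hpow0
  have hg0 : g 0 = 0 := by simp [hg, hp1]
  have hgc0 : ContinuousAt g 0 := by
    rw [ContinuousAt, hg0]
    set C := C₂ * s ^ (r + 1) * p
    have hC : Tendsto (fun τ : ℝ => C * |τ|) (𝓝 0) (𝓝 0) := by
      have : Continuous fun τ : ℝ => C * |τ| := by fun_prop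
      simpa using this.tendsto 0
    refine squeeze_zero_norm' ?_ hC
    have hs₀' : ∀ᶠ τ : ℝ in 𝓝 0, s * τ ^ p < s₀ :=
      (hpow0.mono_right nhdsWithin_le_nhds).eventually (gt_mem_nhds hs₀)
    filter_upwards [hs₀', Metric.ball_mem_nhds (0 : ℝ) one_pos] with τ h1 h2
    rcases eq_or_ne τ 0 with rfl | hτ
    · simp [hg0]
    have hτ' : 0 < |τ| := abs_pos.mpr hτ
    have hτ1 : |τ| ≤ 1 := by simpa using (Metric.mem_ball.mp h2).le
    set t := s * τ ^ p with ht
    have ht0 : 0 < t := hpos τ hτ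
    have hup := (hgr t ⟨ht0, h1⟩).2
    -- Multiplying by |τ| turns the derivative into p t F'(t), to which the growth bound C₂ t^(r+1)
    -- applies directly.
    have h3 : ‖g τ‖ * |τ| = deriv F t * t * p := by
      rw [hg, Real.norm_eq_abs, ← abs_mul]
      have : deriv F (s * τ ^ p) * (s * (p * τ ^ (p - 1))) * τ = deriv F t * t * p := by
        rw [← ht, ht, ← pow_sub_one_mul hp0 τ]; ring
      rw [this, abs_of_nonneg]
      exact mul_nonneg (mul_nonneg (hφ.deriv_pos t ht0).le ht0.le) p.cast_nonneg
    have h4 : deriv F t * t ≤ C₂ * t ^ (r + 1) := by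
      calc deriv F t * t ≤ C₂ * t ^ r * t := mul_le_mul_of_nonneg_right hup ht0.le
        _ = _ := by rw [Real.rpow_add_one ht0.ne', mul_assoc]
    have h5 : t ^ (r + 1) ≤ s ^ (r + 1) * |τ| ^ 2 := by
      rw [ht, ← hpe.pow_abs, Real.mul_rpow hs.le (by positivity), ← Real.rpow_natCast |τ| p,
        ← Real.rpow_mul hτ'.le, ← Real.rpow_natCast |τ| 2]
      refine mul_le_mul_of_nonneg_left ?_ (by positivity)
      exact Real.rpow_le_rpow_of_exponent_ge hτ' hτ1 (by exact_mod_cast hpκ)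
    have h6 : ‖g τ‖ * |τ| ≤ (C * |τ|) * |τ| := by
      rw [h3]
      calc deriv F t * t * p ≤ C₂ * (s ^ (r + 1) * |τ| ^ 2) * p := by
            refine mul_le_mul_of_nonneg_right (h4.trans ?_) p.cast_nonneg
            exact mul_le_mul_of_nonneg_left h5 hC₂.le
        _ = _ := by ring
    exact le_of_mul_le_mul_right h6 hτ'
  have hHd' := hasDerivAt_of_hasDerivAt_of_ne' hHd hHc hgc0
  refine ⟨p, hp0, hpe, ?_⟩
  rw [contDiff_one_iff_deriv]
  refine ⟨fun τ => (hHd' τ).differentiableAt, ?_⟩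
  have hde : deriv (fun τ : ℝ => F (s * τ ^ p)) = g := funext fun τ => (hHd' τ).deriv
  change Continuous (deriv (fun τ : ℝ => F (s * τ ^ p)))
  rw [hde, continuous_iff_continuousAt]
  intro τ
  rcases eq_or_ne τ 0 with rfl | hτ
  · exact hgc0
  · have h1 : ContinuousAt (deriv F) (s * τ ^ p) :=
      hFc.continuousAt (Ioi_mem_nhds (hpos τ hτ))
    have h2 : ContinuousAt (fun τ : ℝ => s * τ ^ p) τ := by fun_prop
    exact (ContinuousAt.comp (f := fun τ : ℝ => s * τ ^ p) h1 h2).mul (by fun_prop)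

open scoped Manifold in
theorem exists_contDiff_cutoff {E : Type*} [NormedAddCommGroup E] [NormedSpace ℝ E]
    [FiniteDimensional ℝ E] {K Ω : Set E} (hK : IsCompact K) (hΩ : IsOpen Ω) (hKΩ : K ⊆ Ω) :
    ∃ ρ : E → ℝ, ContDiff ℝ 1 ρ ∧ HasCompactSupport ρ ∧ tsupport ρ ⊆ Ω ∧
      ∀ᶠ x in 𝓝ˢ K, ρ x = 1 := by
  obtain ⟨L, hL, hKL, hLΩ⟩ := exists_compact_between hK hΩ hKΩ
  obtain ⟨f, h1, h0, -⟩ := exists_contMDiffMap_one_nhds_of_subset_interior (n := 1) 𝓘(ℝ, E)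
    hK.isClosed hKL
  have hsub : tsupport f ⊆ L := by
    refine closure_minimal (fun x hx => ?_) hL.isClosed
    by_contra hxL
    exact hx (h0 x hxL)
  exact ⟨f, f.contMDiff.contDiff, hL.of_isClosed_subset (isClosed_tsupport _) hsub,
    hsub.trans hLΩ, h1⟩

variable {n m : ℕ}

/-- A plain cutoff times z can destroy the C¹ regularity of φ(|u|)u where the cutoff vanishes.
Raising the cutoff to the power from `exists_even_pow_contDiff` restores it. -/
theorem exists_isTest_eq_const (hφ : Admissible φ) {K Ω : Set (EuclideanSpace ℝ (Fin n))}
    (hK : IsCompact K) (hΩ : IsOpen Ω) (hKΩ : K ⊆ Ω) {z : EuclideanSpace ℂ (Fin m)} (hz : z ≠ 0) :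
    ∃ u, IsTest Ω u ∧ IsTest Ω (phiMul φ u) ∧ ∀ᶠ x in 𝓝ˢ K, u x = z := by
  obtain ⟨ρ, hρ, hρc, hρΩ, hρ1⟩ := exists_contDiff_cutoff hK hΩ hKΩ
  have hs := norm_pos_iff.mpr hz
  obtain ⟨p, hp0, hpe, hp⟩ := exists_even_pow_contDiff hφ hs
  have hsupp : ∀ w : EuclideanSpace ℝ (Fin n) → EuclideanSpace ℂ (Fin m),
      (∀ x, ρ x = 0 → w x = 0) → tsupport w ⊆ tsupport ρ := fun w hw =>
    closure_mono fun x hx h => hx (hw x h)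
  have htest : ∀ w : EuclideanSpace ℝ (Fin n) → EuclideanSpace ℂ (Fin m),
      ContDiff ℝ 1 w → (∀ x, ρ x = 0 → w x = 0) → IsTest Ω w := fun w h1 h2 =>
    ⟨h1, hρc.of_isClosed_subset (isClosed_tsupport _) (hsupp w h2), (hsupp w h2).trans hρΩ⟩
  refine ⟨fun x => ρ x ^ p • z, htest _ (by fun_prop) fun x hx => by simp [hx, hp0],
    htest _ ?_ fun x hx => by simp [phiMul, hx, hp0], ?_⟩
  · have h1 : phiMul φ (fun x => ρ x ^ p • z) =
        fun x => (‖z‖⁻¹ * ((‖z‖ * ρ x ^ p) * φ (‖z‖ * ρ x ^ p))) • z := by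
      ext1 x
      rw [phiMul, norm_smul, Real.norm_of_nonneg (hpe.pow_nonneg _), smul_smul, mul_comm ‖z‖]
      congr 1
      field_simp
    rw [h1]
    exact (contDiff_const.mul (hp.comp hρ)).smul contDiff_const
  · filter_upwards [hρ1] with x hx
    simp [hx]

end Cutoff

/-! ### Rapidly oscillating perturbations -/

section Oscillation

variable {n m : ℕ} {φ : ℝ → ℝ}

theorem inner_realAct_eq_sum (M : Matrix (Fin m) (Fin m) ℝ) (p q : EuclideanSpace ℂ (Fin m)) :
    inner ℝ p (realAct M q) = ∑ i, ∑ j, M i j * inner ℝ (p i) (q j) := by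
  rw [PiLp.inner_apply]
  refine Finset.sum_congr rfl fun i _ => ?_
  rw [realAct_apply_apply, inner_sum]
  refine Finset.sum_congr rfl fun j _ => ?_
  rw [← Complex.real_smul, real_inner_smul_right]

theorem inner_complex_realAct_eq_sum (M : Matrix (Fin m) (Fin m) ℝ)
    (p q : EuclideanSpace ℂ (Fin m)) :
    inner ℂ p (realAct M q) = ∑ i, ∑ j, (M i j : ℂ) * inner ℂ (p i) (q j) := by
  rw [PiLp.inner_apply]
  refine Finset.sum_congr rfl fun i _ => ?_
  rw [realAct_apply_apply, inner_sum]
  refine Finset.sum_congr rfl fun j _ => ?_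
  rw [← smul_eq_mul, inner_smul_right]

theorem continuous_pderiv {u : EuclideanSpace ℝ (Fin n) → EuclideanSpace ℂ (Fin m)}
    (hu : ContDiff ℝ 1 u) (k : Fin n) : Continuous (pderiv k u) :=
  (hu.continuous_fderiv one_ne_zero).clm_apply continuous_const

theorem pderiv_eq_zero_of_notMem {u : EuclideanSpace ℝ (Fin n) → EuclideanSpace ℂ (Fin m)}
    {x : EuclideanSpace ℝ (Fin n)} (hx : x ∉ tsupport u) (k : Fin n) : pderiv k u x = 0 := by
  have : fderiv ℝ u x = 0 := by
    by_contra h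
    exact hx (support_fderiv_subset ℝ h)
  simp [pderiv, this]

theorem exists_pderiv_bound {u : EuclideanSpace ℝ (Fin n) → EuclideanSpace ℂ (Fin m)}
    (hu : ContDiff ℝ 1 u) (hc : HasCompactSupport u) :
    ∃ C, 0 ≤ C ∧ ∀ k x, ‖pderiv k u x‖ ≤ C := by
  obtain ⟨C, hC⟩ := (hu.continuous_fderiv one_ne_zero).bounded_above_of_compact_support
    (hc.fderiv ℝ)
  refine ⟨C, (norm_nonneg _).trans (hC 0), fun k x => ?_⟩
  refine ((fderiv ℝ u x).le_opNorm _).trans ?_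
  rw [PiLp.norm_single, norm_one, mul_one]
  exact hC x

theorem integrable_mul_of_tsupport_subset {Ω : Set (EuclideanSpace ℝ (Fin n))}
    {f : EuclideanSpace ℝ (Fin n) → ℝ} (hf : LocallyIntegrableOn f Ω volume)
    {ψ : EuclideanSpace ℝ (Fin n) → ℂ} (hψ : Continuous ψ) {K : Set (EuclideanSpace ℝ (Fin n))}
    (hK : IsCompact K) (hKΩ : K ⊆ Ω) (h0 : ∀ x ∉ K, ψ x = 0) :
    Integrable (fun x => (f x : ℂ) * ψ x) (volume.restrict Ω) := by
  have h1 : IntegrableOn (fun x => (f x : ℂ)) K :=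
    (hf.integrableOn_compact_subset hKΩ hK).ofReal
  have h2 : IntegrableOn (fun x => (f x : ℂ) * ψ x) K := h1.mul_continuousOn hψ.continuousOn hK
  refine Integrable.integrableOn ((integrableOn_iff_integrable_of_support_subset ?_).mp h2)
  intro x hx
  by_contra hxK
  exact hx (by simp [h0 x hxK])

theorem integrable_integrand {Ω : Set (EuclideanSpace ℝ (Fin n))}
    {A : Fin n → EuclideanSpace ℝ (Fin n) → Matrix (Fin m) (Fin m) ℝ}
    (hA : ∀ h i j, LocallyIntegrableOn (fun x => A h x i j) Ω volume)
    {u v : EuclideanSpace ℝ (Fin n) → EuclideanSpace ℂ (Fin m)} (hu : IsTest Ω u)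
    (hv : IsTest Ω v) :
    Integrable (fun x => ∑ k, inner ℂ (pderiv k v x) (realAct (A k x) (pderiv k u x)))
      (volume.restrict Ω) := by
  refine integrable_finsetSum _ fun k _ => ?_
  simp only [inner_complex_realAct_eq_sum]
  refine integrable_finsetSum _ fun i _ => integrable_finsetSum _ fun j _ => ?_
  have hc1 := continuous_pderiv hu.1 k
  have hc2 := continuous_pderiv hv.1 k
  refine integrable_mul_of_tsupport_subset (hA k i j) (by fun_prop) hu.2.1 hu.2.2 fun x hx => ?_
  simp [pderiv_eq_zero_of_notMem hx]

/-- A rapidly oscillating perturbation of `u₀` in the direction `ξ`, with amplitude `η / c` and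
frequency `c ^ 2`. -/
def oscillate (u₀ : EuclideanSpace ℝ (Fin n) → EuclideanSpace ℂ (Fin m))
    (η : EuclideanSpace ℝ (Fin n) → ℝ) (ξ : EuclideanSpace ℂ (Fin m)) (h : Fin n) (θ c : ℝ)
    (x : EuclideanSpace ℝ (Fin n)) : EuclideanSpace ℂ (Fin m) :=
  u₀ x + (c⁻¹ * (η x * Real.cos (c ^ 2 * x h + θ))) • ξ

/-- The coefficient of `ξ` in the rescaled derivative of `oscillate`. -/
def oscCoeff (η : EuclideanSpace ℝ (Fin n) → ℝ) (h k : Fin n) (θ c : ℝ)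
    (x : EuclideanSpace ℝ (Fin n)) : ℝ :=
  c⁻¹ ^ 2 * fderiv ℝ η x (EuclideanSpace.single k 1) * Real.cos (c ^ 2 * x h + θ) -
    η x * Real.sin (c ^ 2 * x h + θ) * (if k = h then 1 else 0)

variable {u₀ : EuclideanSpace ℝ (Fin n) → EuclideanSpace ℂ (Fin m)}
    {η : EuclideanSpace ℝ (Fin n) → ℝ} {ξ z : EuclideanSpace ℂ (Fin m)} {h : Fin n}

theorem contDiff_oscillate (hu : ContDiff ℝ 1 u₀) (hη : ContDiff ℝ 1 η) (θ c : ℝ) :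
    ContDiff ℝ 1 (oscillate u₀ η ξ h θ c) := by
  have : ContDiff ℝ 1 fun x : EuclideanSpace ℝ (Fin n) => x h :=
    (EuclideanSpace.proj (𝕜 := ℝ) h).contDiff
  unfold oscillate
  fun_prop

theorem pderiv_oscillate (hu : ContDiff ℝ 1 u₀) (hη : ContDiff ℝ 1 η) (θ : ℝ) {c : ℝ}
    (hc : c ≠ 0) (k : Fin n) (x : EuclideanSpace ℝ (Fin n)) :
    pderiv k (oscillate u₀ η ξ h θ c) x =
      pderiv k u₀ x + (c * oscCoeff η h k θ c x) • ξ := by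
  have h1 := (hu.differentiable one_ne_zero x).hasFDerivAt
  have h2 := (hη.differentiable one_ne_zero x).hasFDerivAt
  have h3 : HasFDerivAt (fun x : EuclideanSpace ℝ (Fin n) => c ^ 2 * x h + θ)
      (c ^ 2 • (EuclideanSpace.proj (𝕜 := ℝ) h : EuclideanSpace ℝ (Fin n) →L[ℝ] ℝ)) x :=
    ((EuclideanSpace.proj (𝕜 := ℝ) h).hasFDerivAt.const_mul (c ^ 2)).add_const θ
  have h4 := h1.add (((h2.mul h3.cos).const_mul c⁻¹).smul_const ξ)
  have h5 : HasFDerivAt (oscillate u₀ η ξ h θ c) _ x := h4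
  have h6 : (EuclideanSpace.proj (𝕜 := ℝ) h : EuclideanSpace ℝ (Fin n) →L[ℝ] ℝ)
      (EuclideanSpace.single k 1) = if k = h then 1 else 0 := by
    simp [eq_comm]
  rw [pderiv, h5.fderiv, oscCoeff]
  simp only [pderiv, add_apply, smul_apply, ContinuousLinearMap.smulRight_apply, smul_eq_mul, h6]
  congr 2
  field_simp
  ring

/-- The phases 0 and π/2 exchange cosine and sine up to sign, so the sum of squares no longer
oscillates. This replaces the weak convergence of sin² to its mean by a pointwise limit. -/
theorem sq_oscCoeff_add_sq (k : Fin n) (c : ℝ) (x : EuclideanSpace ℝ (Fin n)) :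
    oscCoeff η h k 0 c x ^ 2 + oscCoeff η h k (Real.pi / 2) c x ^ 2 =
      (c⁻¹ ^ 2 * fderiv ℝ η x (EuclideanSpace.single k 1)) ^ 2 +
        η x ^ 2 * (if k = h then 1 else 0) := by
  simp only [oscCoeff, Real.cos_add_pi_div_two, Real.sin_add_pi_div_two, add_zero]
  have := Real.sin_sq_add_cos_sq (c ^ 2 * x h)
  split_ifs
  · linear_combination ((c⁻¹ ^ 2 * fderiv ℝ η x (EuclideanSpace.single k 1)) ^ 2 + η x ^ 2) * this
  · linear_combination ((c⁻¹ ^ 2 * fderiv ℝ η x (EuclideanSpace.single k 1)) ^ 2) * this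

theorem abs_oscCoeff_le {C : ℝ} (hη0 : ∀ x, |η x| ≤ C)
    (hη1 : ∀ k x, |fderiv ℝ η x (EuclideanSpace.single k 1)| ≤ C) (k : Fin n) (θ : ℝ) {c : ℝ}
    (hc : 1 ≤ c) (x : EuclideanSpace ℝ (Fin n)) : |oscCoeff η h k θ c x| ≤ 2 * C := by
  have hC : 0 ≤ C := (abs_nonneg _).trans (hη0 x)
  have h1 : |c⁻¹ ^ 2 * fderiv ℝ η x (EuclideanSpace.single k 1) * Real.cos (c ^ 2 * x h + θ)|
      ≤ 1 * C * 1 := by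
    rw [abs_mul, abs_mul]
    gcongr
    · rw [abs_of_nonneg (by positivity)]
      exact pow_le_one₀ (by positivity) (inv_le_one_of_one_le₀ hc)
    · exact hη1 k x
    · exact Real.abs_cos_le_one _
  have h2 : |η x * Real.sin (c ^ 2 * x h + θ) * (if k = h then 1 else 0)| ≤ C * 1 * 1 := by
    rw [abs_mul, abs_mul]
    gcongr
    · exact hη0 x
    · exact Real.abs_sin_le_one _
    · split_ifs <;> simp
  calc |oscCoeff η h k θ c x| ≤ _ + _ := abs_sub _ _
    _ ≤ 1 * C * 1 + C * 1 * 1 := add_le_add h1 h2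
    _ = 2 * C := by ring

theorem oscillate_eventuallyEq {x : EuclideanSpace ℝ (Fin n)} (hx : x ∉ tsupport η) (θ c : ℝ) :
    oscillate u₀ η ξ h θ c =ᶠ[𝓝 x] u₀ := by
  filter_upwards [notMem_tsupport_iff_eventuallyEq.mp hx] with y hy
  simp [oscillate, hy]

theorem norm_oscillate_sub_le {C : ℝ} (hη0 : ∀ x, |η x| ≤ C) (θ : ℝ) {c : ℝ} (hc : 0 < c)
    (x : EuclideanSpace ℝ (Fin n)) :
    ‖oscillate u₀ η ξ h θ c x - u₀ x‖ ≤ c⁻¹ * (C * ‖ξ‖) := by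
  have hC : 0 ≤ C := (abs_nonneg _).trans (hη0 x)
  rw [oscillate, add_sub_cancel_left, norm_smul, Real.norm_eq_abs, abs_mul, abs_mul,
    abs_of_pos (inv_pos.mpr hc), mul_assoc]
  gcongr
  calc |η x| * |Real.cos (c ^ 2 * x h + θ)| ≤ C * 1 := by
        gcongr
        · exact hη0 x
        · exact Real.abs_cos_le_one _
    _ = C := mul_one C

theorem isTest_of_eqOn_compl {Ω K : Set (EuclideanSpace ℝ (Fin n))} (hK : IsCompact K)
    (hKΩ : K ⊆ Ω) {u : EuclideanSpace ℝ (Fin n) → EuclideanSpace ℂ (Fin m)}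
    (hu : ContDiff ℝ 1 u) (h0 : ∀ x ∉ K, u x = 0) : IsTest Ω u := by
  have hsub : tsupport u ⊆ K := closure_minimal (fun x hx => by
    by_contra hxK
    exact hx (h0 x hxK)) hK.isClosed
  exact ⟨hu, hK.of_isClosed_subset (isClosed_tsupport _) hsub, hsub.trans hKΩ⟩

/-- The weights a₀² and a₁² need not converge separately. Each is dominated by the convergent T, so
replacing q₀ and q₁ by their common limit costs o(1). -/
theorem tendsto_weighted_sum {a₀ a₁ q₀ q₁ T : ℝ → ℝ} {t q : ℝ} {l : Filter ℝ}
    (hsum : ∀ c, a₀ c ^ 2 + a₁ c ^ 2 = T c) (hT : Tendsto T l (𝓝 t)) (h₀ : Tendsto q₀ l (𝓝 q))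
    (h₁ : Tendsto q₁ l (𝓝 q)) :
    Tendsto (fun c => a₀ c ^ 2 * q₀ c + a₁ c ^ 2 * q₁ c) l (𝓝 (t * q)) := by
  have key : ∀ a p : ℝ → ℝ, (∀ c, a c ^ 2 ≤ T c) → Tendsto p l (𝓝 q) →
      Tendsto (fun c => a c ^ 2 * (p c - q)) l (𝓝 0) := by
    intro a p ha hp
    have h2 : Tendsto (fun c => T c * |p c - q|) l (𝓝 0) := by
      simpa using hT.mul (hp.sub_const q).abs
    refine squeeze_zero_norm (fun c => ?_) h2
    rw [norm_mul, Real.norm_of_nonneg (sq_nonneg _), Real.norm_eq_abs]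
    exact mul_le_mul_of_nonneg_right (ha c) (abs_nonneg _)
  have h3 := ((key a₀ q₀ (fun c => by rw [← hsum c]; nlinarith [sq_nonneg (a₁ c)]) h₀).add
    (key a₁ q₁ (fun c => by rw [← hsum c]; nlinarith [sq_nonneg (a₀ c)]) h₁)).add
    (hT.mul_const q)
  rw [zero_add, zero_add] at h3
  refine h3.congr fun c => ?_
  rw [← hsum c]
  ring

end Oscillation

/-! ### The high-frequency limit of the dissipativity inequality -/

section Limit

variable {n m : ℕ} {φ : ℝ → ℝ}

theorem exists_radius_fderiv_radialMap_bound (hφ : Admissible φ) {z : EuclideanSpace ℂ (Fin m)}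
    (hz : z ≠ 0) : ContinuousAt (fderiv ℝ (radialMap φ)) z ∧
      ∃ r M : ℝ, 0 < r ∧ 0 ≤ M ∧ ∀ y, ‖y - z‖ < r → y ≠ 0 ∧ ‖fderiv ℝ (radialMap φ) y‖ ≤ M := by
  have hc : ContinuousAt (fderiv ℝ (radialMap φ)) z :=
    ((contDiffAt_radialMap hφ hz).fderiv_right (m := 0) le_rfl).continuousAt
  refine ⟨hc, ?_⟩
  have h1 : ∀ᶠ y in 𝓝 z, y ≠ 0 := isOpen_ne.mem_nhds hz
  have h2 : ∀ᶠ y in 𝓝 z, ‖fderiv ℝ (radialMap φ) y‖ ≤ ‖fderiv ℝ (radialMap φ) z‖ + 1 :=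
    hc.norm.eventually (ge_mem_nhds (lt_add_one _))
  obtain ⟨r, hr, h⟩ := Metric.eventually_nhds_iff.mp (h1.and h2)
  exact ⟨r, _, hr, by positivity, fun y hy => h (by rwa [dist_eq_norm])⟩

/-- On the support of η the unperturbed function is constant, so the derivatives of the perturbed
one are c · `oscCoeff` · ξ and the form scales like c². The rescaled two-phase sum converges
pointwise and is dominated by a multiple of the entries of the coefficients on a compact subset of
Ω. -/
theorem integral_sq_mul_nonneg (hφ : Admissible φ) {Ω : Set (EuclideanSpace ℝ (Fin n))}
    (hΩ : IsOpen Ω) {A : Fin n → EuclideanSpace ℝ (Fin n) → Matrix (Fin m) (Fin m) ℝ}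
    (hA : ∀ h i j, LocallyIntegrableOn (fun x => A h x i j) Ω volume)
    (hD : LPhiDissipative φ Ω (diagCoeff A))
    {η : EuclideanSpace ℝ (Fin n) → ℝ} (hη : ContDiff ℝ 1 η) (hηc : HasCompactSupport η)
    (hηΩ : tsupport η ⊆ Ω) {z : EuclideanSpace ℂ (Fin m)} (hz : z ≠ 0)
    (ξ : EuclideanSpace ℂ (Fin m)) (h : Fin n) :
    0 ≤ ∫ x in Ω, η x ^ 2 * inner ℝ (fderiv ℝ (radialMap φ) z ξ) (realAct (A h x) ξ) := by
  obtain ⟨u₀, hu₀, hv₀, hconst⟩ := exists_isTest_eq_const hφ hηc hΩ hηΩ hz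
  rw [eventually_nhdsSet_iff_forall] at hconst
  have hK : IsCompact (tsupport u₀) := hu₀.2.1
  have hout : ∀ x ∉ tsupport u₀, x ∉ tsupport η := fun x hx hxη => by
    refine hx (subset_tsupport _ ?_)
    rw [Function.mem_support, (hconst x hxη).self_of_nhds]
    exact hz
  obtain ⟨hcont, r, M, hr, hM, hball⟩ := exists_radius_fderiv_radialMap_bound hφ hz
  obtain ⟨C, hC0, hη0, hη1⟩ : ∃ C, 0 ≤ C ∧ (∀ x, |η x| ≤ C) ∧
      ∀ k x, |fderiv ℝ η x (EuclideanSpace.single k 1)| ≤ C := by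
    obtain ⟨C₁, h1⟩ := hη.continuous.bounded_above_of_compact_support hηc
    obtain ⟨C₂, h2⟩ := (hη.continuous_fderiv one_ne_zero).bounded_above_of_compact_support
      (hηc.fderiv ℝ)
    refine ⟨max C₁ C₂, ((norm_nonneg _).trans (h1 0)).trans (le_max_left _ _),
      fun x => (h1 x).trans (le_max_left _ _), fun k x => ?_⟩
    refine ((fderiv ℝ η x).le_opNorm _).trans ?_
    rw [PiLp.norm_single, norm_one, mul_one]
    exact (h2 x).trans (le_max_right _ _)
  obtain ⟨B₁, hB₁, hu₀B⟩ := exists_pderiv_bound hu₀.1 hu₀.2.1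
  obtain ⟨B₂, hB₂, hv₀B⟩ := exists_pderiv_bound hv₀.1 hv₀.2.1
  set w : ℝ → ℝ → EuclideanSpace ℝ (Fin n) → EuclideanSpace ℂ (Fin m) :=
    fun θ c => oscillate u₀ η ξ h θ c with hw
  have hgood : ∀ᶠ c : ℝ in atTop, 1 ≤ c ∧ c⁻¹ * (C * ‖ξ‖) < r := by
    refine (eventually_ge_atTop 1).and ?_
    have : Tendsto (fun c : ℝ => c⁻¹ * (C * ‖ξ‖)) atTop (𝓝 0) := by
      simpa using tendsto_inv_atTop_zero.mul_const (C * ‖ξ‖)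
    exact this.eventually (gt_mem_nhds hr)
  have hclose : ∀ {θ c x}, 1 ≤ c → x ∈ tsupport η →
      ‖w θ c x - z‖ ≤ c⁻¹ * (C * ‖ξ‖) := fun {θ c x} hc hx => by
    have := norm_oscillate_sub_le (u₀ := u₀) (ξ := ξ) (h := h) hη0 θ (one_pos.trans_le hc) x
    rwa [(hconst x hx).self_of_nhds] at this
  have hwd : ∀ θ c, ContDiff ℝ 1 (w θ c) := fun θ c => contDiff_oscillate hu₀.1 hη θ c
  have hw_out : ∀ {θ c x}, x ∉ tsupport η → w θ c =ᶠ[𝓝 x] u₀ := fun hx =>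
    oscillate_eventuallyEq hx _ _
  have hv_out : ∀ {θ c x}, x ∉ tsupport η → phiMul φ (w θ c) =ᶠ[𝓝 x] phiMul φ u₀ := fun hx =>
    (hw_out hx).fun_comp (radialMap φ)
  -- On the support of η the perturbed function stays in a ball around z that avoids 0, where the
  -- radial map is C¹; elsewhere it coincides locally with u₀.
  have htest : ∀ {θ c}, 1 ≤ c → c⁻¹ * (C * ‖ξ‖) < r →
      IsTest Ω (w θ c) ∧ IsTest Ω (phiMul φ (w θ c)) := fun {θ c} hc hcr => by
    refine ⟨isTest_of_eqOn_compl hK hu₀.2.2 (hwd θ c) fun x hx => ?_,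
      isTest_of_eqOn_compl hK hu₀.2.2 ?_ fun x hx => ?_⟩
    · rw [(hw_out (hout x hx)).self_of_nhds, image_eq_zero_of_notMem_tsupport hx]
    · rw [contDiff_iff_contDiffAt]
      intro x
      by_cases hx : x ∈ tsupport η
      · exact (contDiffAt_radialMap hφ (hball _ ((hclose hc hx).trans_lt hcr)).1).comp x
          (hwd θ c).contDiffAt
      · exact hv₀.1.contDiffAt.congr_of_eventuallyEq (hv_out hx)
    · rw [(hv_out (hout x hx)).self_of_nhds, phiMul, image_eq_zero_of_notMem_tsupport hx, smul_zero]
  have hpw_out : ∀ {θ c x} (k : Fin n), x ∉ tsupport η →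
      pderiv k (w θ c) x = pderiv k u₀ x ∧
        pderiv k (phiMul φ (w θ c)) x = pderiv k (phiMul φ u₀) x := fun k hx => by
    simp only [pderiv, (hw_out hx).fderiv_eq, (hv_out hx).fderiv_eq, and_self]
  have hpw : ∀ {θ c} (k : Fin n) (x), 1 ≤ c →
      pderiv k (w θ c) x = pderiv k u₀ x + (c * oscCoeff η h k θ c x) • ξ := fun k x hc =>
    pderiv_oscillate hu₀.1 hη _ (one_pos.trans_le hc).ne' k x
  have hpv_in : ∀ {θ c x} (k : Fin n), 1 ≤ c → c⁻¹ * (C * ‖ξ‖) < r → x ∈ tsupport η →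
      pderiv k (phiMul φ (w θ c)) x =
        fderiv ℝ (radialMap φ) (w θ c x) (pderiv k (w θ c) x) := fun {θ c x} k hc hcr hx => by
    rw [pderiv, phiMul_eq_comp, fderiv_comp x ((contDiffAt_radialMap hφ
      (hball _ ((hclose hc hx).trans_lt hcr)).1).differentiableAt one_ne_zero)
      ((hwd θ c).differentiable one_ne_zero x)]
    rfl
  set B := B₁ + 2 * C * ‖ξ‖ with hB
  have hB0 : 0 ≤ B := by positivity
  have hpw_le : ∀ {θ c} (k : Fin n) (x), 1 ≤ c → ‖pderiv k (w θ c) x‖ ≤ c * B :=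
    fun {θ c} k x hc => by
      have hc0 : 0 ≤ c := by linarith
      rw [hpw k x hc]
      calc _ ≤ B₁ + c * (2 * C) * ‖ξ‖ := by
            refine (norm_add_le _ _).trans (add_le_add (hu₀B k x) ?_)
            rw [norm_smul, Real.norm_eq_abs, abs_mul, abs_of_nonneg hc0]
            gcongr
            exact abs_oscCoeff_le hη0 hη1 k θ hc x
        _ ≤ c * B₁ + c * (2 * C) * ‖ξ‖ := by
            gcongr
            exact le_mul_of_one_le_left hB₁ hc
        _ = c * B := by ring
  have hpv_le : ∀ {θ c} (k : Fin n) (x), 1 ≤ c → c⁻¹ * (C * ‖ξ‖) < r →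
      ‖pderiv k (phiMul φ (w θ c)) x‖ ≤ c * (B₂ + M * B) := fun {θ c} k x hc hcr => by
    have hc0 : 0 ≤ c := by linarith
    by_cases hx : x ∈ tsupport η
    · rw [hpv_in k hc hcr hx]
      calc _ ≤ M * (c * B) := ((fderiv ℝ (radialMap φ) (w θ c x)).le_opNorm _).trans
            (mul_le_mul (hball _ ((hclose hc hx).trans_lt hcr)).2 (hpw_le k x hc)
              (norm_nonneg _) hM)
        _ ≤ c * B₂ + M * (c * B) := le_add_of_nonneg_left (by positivity)
        _ = _ := by ring
    · rw [(hpw_out k hx).2]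
      calc _ ≤ B₂ := hv₀B k x
        _ ≤ c * B₂ := le_mul_of_one_le_left hB₂ hc
        _ ≤ _ := by gcongr; exact le_add_of_nonneg_right (by positivity)
  set g : ℝ → ℝ → EuclideanSpace ℝ (Fin n) → ℝ := fun θ c x =>
    ∑ k, inner ℝ (pderiv k (phiMul φ (w θ c)) x) (realAct (A k x) (pderiv k (w θ c) x)) with hg
  have hg_int : ∀ {θ c}, 1 ≤ c → c⁻¹ * (C * ‖ξ‖) < r →
      Integrable (g θ c) (volume.restrict Ω) ∧ 0 ≤ ∫ x in Ω, g θ c x := fun {θ c} hc hcr => by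
    obtain ⟨h1, h2⟩ := htest (θ := θ) hc hcr
    have hi := integrable_integrand hA h1 h2
    have hre : g θ c = fun x => (∑ k, inner ℂ (pderiv k (phiMul φ (w θ c)) x)
        (realAct (A k x) (pderiv k (w θ c) x))).re := by
      ext1 x
      simp only [hg, Complex.re_sum, re_inner_eq_inner_real]
    have hd := hD _ h1 h2
    simp only [diagCoeff_integrand] at hd
    rw [hre]
    exact ⟨hi.re, hd.trans_eq (integral_re hi).symm⟩
  -- The factor c⁻² compensates two derivatives of order c.
  set G : ℝ → EuclideanSpace ℝ (Fin n) → ℝ := fun c x =>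
    c⁻¹ ^ 2 * (g 0 c x + g (Real.pi / 2) c x) with hG
  set S : EuclideanSpace ℝ (Fin n) → ℝ := fun x => ∑ k, ∑ i, ∑ j, |A k x i j| with hS
  set D := (B₂ + M * B) * B with hDdef
  have hD0 : 0 ≤ D := by positivity
  have hg_le : ∀ {θ c} (x), 1 ≤ c → c⁻¹ * (C * ‖ξ‖) < r →
      |g θ c x| ≤ c ^ 2 * (D * S x) := fun {θ c} x hc hcr => by
    have hc0 : 0 ≤ c := by linarith
    refine (Finset.abs_sum_le_sum_abs _ _).trans ?_
    rw [hS, Finset.mul_sum, Finset.mul_sum]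
    refine Finset.sum_le_sum fun k _ => ?_
    calc _ ≤ ‖pderiv k (phiMul φ (w θ c)) x‖ * ‖realAct (A k x) (pderiv k (w θ c) x)‖ :=
          abs_real_inner_le_norm _ _
      _ ≤ (c * (B₂ + M * B)) * ((∑ i, ∑ j, |A k x i j|) * (c * B)) := by
          gcongr
          · exact hpv_le k x hc hcr
          · refine (norm_realAct_le _ _).trans ?_
            gcongr
            exact hpw_le k x hc
      _ = _ := by rw [hDdef]; ring
  have hg_zero : ∀ {θ c} (x), x ∉ tsupport u₀ → g θ c x = 0 := fun x hx => by
    refine Finset.sum_eq_zero fun k _ => ?_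
    rw [(hpw_out k (hout x hx)).1, pderiv_eq_zero_of_notMem hx, map_zero, inner_zero_right]
  have hG_le : ∀ {c} (x), 1 ≤ c → c⁻¹ * (C * ‖ξ‖) < r →
      ‖G c x‖ ≤ (tsupport u₀).indicator (fun x => 2 * (D * S x)) x := fun {c} x hc hcr => by
    by_cases hx : x ∈ tsupport u₀
    · rw [indicator_of_mem hx, hG, norm_mul, Real.norm_of_nonneg (by positivity), Real.norm_eq_abs]
      have hc0 : c ≠ 0 := by linarith
      calc _ ≤ c⁻¹ ^ 2 * (c ^ 2 * (D * S x) + c ^ 2 * (D * S x)) := by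
            gcongr
            exact (abs_add_le _ _).trans (add_le_add (hg_le x hc hcr) (hg_le x hc hcr))
        _ = _ := by field_simp; ring
    · simp only [hG, hg_zero x hx, indicator_of_notMem hx, add_zero, mul_zero, norm_zero, le_refl]
  have hbound : Integrable ((tsupport u₀).indicator (fun x => 2 * (D * S x)))
      (volume.restrict Ω) := by
    refine Integrable.integrableOn ?_
    rw [integrable_indicator_iff hK.measurableSet]
    refine Integrable.const_mul (Integrable.const_mul ?_ _) _
    refine integrable_finsetSum _ fun k _ => integrable_finsetSum _ fun i _ =>
      integrable_finsetSum _ fun j _ => ?_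
    exact ((hA k i j).integrableOn_compact_subset hu₀.2.2 hK).abs
  have hlim : ∀ x, Tendsto (fun c => G c x) atTop
      (𝓝 (η x ^ 2 * inner ℝ (fderiv ℝ (radialMap φ) z ξ) (realAct (A h x) ξ))) := by
    intro x
    have hinv : Tendsto (fun c : ℝ => c⁻¹ ^ 2) atTop (𝓝 0) := by
      simpa using (tendsto_inv_atTop_zero (𝕜 := ℝ)).pow 2
    by_cases hx : x ∈ tsupport η
    · have hwz : ∀ θ, Tendsto (fun c => w θ c x) atTop (𝓝 z) := by
        intro θ
        rw [tendsto_iff_norm_sub_tendsto_zero]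
        refine squeeze_zero' (Eventually.of_forall fun c => norm_nonneg _) ?_
          (by simpa using tendsto_inv_atTop_zero.mul_const (C * ‖ξ‖))
        filter_upwards [eventually_ge_atTop 1] with c hc using hclose hc hx
      have hq : ∀ θ k, Tendsto
          (fun c => inner ℝ (fderiv ℝ (radialMap φ) (w θ c x) ξ) (realAct (A k x) ξ)) atTop
          (𝓝 (inner ℝ (fderiv ℝ (radialMap φ) z ξ) (realAct (A k x) ξ))) := fun θ k => by
        have h1 : Tendsto (fun c => fderiv ℝ (radialMap φ) (w θ c x)) atTop
            (𝓝 (fderiv ℝ (radialMap φ) z)) := hcont.tendsto.comp (hwz θ)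
        have h2 := ((ContinuousLinearMap.apply ℝ (EuclideanSpace ℂ (Fin m)) ξ).continuous.tendsto
          (fderiv ℝ (radialMap φ) z)).comp h1
        exact h2.inner tendsto_const_nhds
      have hT : ∀ k, Tendsto (fun c : ℝ =>
          (c⁻¹ ^ 2 * fderiv ℝ η x (EuclideanSpace.single k 1)) ^ 2 +
            η x ^ 2 * (if k = h then 1 else 0)) atTop
          (𝓝 (η x ^ 2 * (if k = h then 1 else 0))) := fun k => by
        have h1 := ((hinv.mul_const (fderiv ℝ η x (EuclideanSpace.single k 1))).pow 2).add_const
          (η x ^ 2 * (if k = h then 1 else 0))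
        rwa [zero_mul, zero_pow two_ne_zero, zero_add] at h1
      have hsum := tendsto_finsetSum Finset.univ fun k _ => tendsto_weighted_sum
        (fun c => sq_oscCoeff_add_sq (η := η) (h := h) k c x) (hT k) (hq 0 k) (hq (Real.pi / 2) k)
      have hval : ∑ k, η x ^ 2 * (if k = h then 1 else 0) *
          inner ℝ (fderiv ℝ (radialMap φ) z ξ) (realAct (A k x) ξ) =
          η x ^ 2 * inner ℝ (fderiv ℝ (radialMap φ) z ξ) (realAct (A h x) ξ) := by
        simp
      rw [hval] at hsum
      refine hsum.congr' ?_
      filter_upwards [hgood] with c hc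
      have hc0 : c ≠ 0 := by linarith
      have hgx : ∀ θ, g θ c x = ∑ k, c ^ 2 * (oscCoeff η h k θ c x ^ 2 *
          inner ℝ (fderiv ℝ (radialMap φ) (w θ c x) ξ) (realAct (A k x) ξ)) := fun θ => by
        refine Finset.sum_congr rfl fun k _ => ?_
        have h0 : pderiv k u₀ x = 0 := by
          have h1 : u₀ =ᶠ[𝓝 x] fun _ => z := hconst x hx
          rw [pderiv, h1.fderiv_eq]
          simp
        rw [hpv_in k hc.1 hc.2 hx, hpw k x hc.1, h0, zero_add, map_smul, map_smul,
          real_inner_smul_left, real_inner_smul_right]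
        ring
      simp only [hG, hgx]
      rw [← Finset.sum_add_distrib, Finset.mul_sum]
      refine Finset.sum_congr rfl fun k _ => ?_
      field_simp
    · have h0 : η x = 0 := image_eq_zero_of_notMem_tsupport hx
      -- Off the support of η the perturbation is absent, so only the prefactor depends on c.
      have hGx : ∀ c, G c x = c⁻¹ ^ 2 * (G 1 x) := fun c => by
        simp only [hG, hg, (hpw_out _ hx).1, (hpw_out _ hx).2, inv_one, one_pow, one_mul]
      rw [funext hGx, h0]
      simpa using hinv.mul_const (G 1 x)
  have hmain := tendsto_integral_filter_of_dominated_convergence (μ := volume.restrict Ω) _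
    (hgood.mono fun c hc => ((hg_int hc.1 hc.2).1.add (hg_int hc.1 hc.2).1).const_mul
      (c⁻¹ ^ 2) |>.aestronglyMeasurable)
    (hgood.mono fun c hc => Eventually.of_forall fun x => hG_le x hc.1 hc.2) hbound
    (Eventually.of_forall hlim)
  refine ge_of_tendsto hmain (hgood.mono fun c hc => ?_)
  change 0 ≤ ∫ x in Ω, c⁻¹ ^ 2 * (g 0 c x + g (Real.pi / 2) c x)
  obtain ⟨i0, n0⟩ := hg_int (θ := 0) hc.1 hc.2
  obtain ⟨i1, n1⟩ := hg_int (θ := Real.pi / 2) hc.1 hc.2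
  rw [integral_const_mul, integral_add i0 i1]
  exact mul_nonneg (sq_nonneg _) (add_nonneg n0 n1)

end Limit

/-! ### From weighted integrals to almost every point -/

section Localization

open scoped Manifold ContDiff in
-- The indicator of K is the pointwise limit of squares of smooth bumps that equal 1 on K and are
-- supported near shrinking thickenings of K; dominated convergence passes to the limit.
theorem setIntegral_nonneg_of_integral_sq_mul_nonneg {E : Type*} [NormedAddCommGroup E]
    [NormedSpace ℝ E] [FiniteDimensional ℝ E] [MeasurableSpace E] [BorelSpace E] {μ : Measure E}
    {Ω K : Set E} (hΩ : IsOpen Ω) {q : E → ℝ} (hq : LocallyIntegrableOn q Ω μ)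
    (h : ∀ η : E → ℝ, ContDiff ℝ 1 η → HasCompactSupport η → tsupport η ⊆ Ω →
      0 ≤ ∫ x in Ω, η x ^ 2 * q x ∂μ) (hK : IsCompact K) (hKΩ : K ⊆ Ω) :
    0 ≤ ∫ x in K, q x ∂μ := by
  have := FiniteDimensional.proper ℝ E
  obtain ⟨δ, δpos, hδ⟩ := hK.exists_cthickening_subset_open hΩ hKΩ
  have hL : IsCompact (Metric.cthickening δ K) := hK.cthickening
  obtain ⟨u, -, u_pos, u_lim⟩ := exists_seq_strictAnti_tendsto' δpos
  have hex : ∀ j, ∃ g : E → ℝ, Function.support g = Metric.thickening (u j) K ∧ ContDiff ℝ 1 g ∧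
      range g ⊆ Icc 0 1 ∧ ∀ x ∈ K, g x = 1 := by
    intro j
    rcases exists_contMDiff_support_eq_eq_one_iff 𝓘(ℝ, E) Metric.isOpen_thickening hK.isClosed
      (Metric.self_subset_thickening (u_pos j).1 K) with ⟨g, g_smooth, g_range, g_supp, hg⟩
    exact ⟨g, g_supp, g_smooth.contDiff.of_le (by exact_mod_cast le_top), g_range,
      fun x hx => (hg x).1 hx⟩
  choose g g_supp g_diff g_range hg using hex
  have hsub : ∀ j, Function.support (g j) ⊆ Metric.cthickening δ K := fun j => by
    rw [g_supp]
    exact Metric.thickening_subset_cthickening_of_le (u_pos j).2.le _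
  have hts : ∀ j, tsupport (g j) ⊆ Metric.cthickening δ K := fun j =>
    closure_minimal (hsub j) Metric.isClosed_cthickening
  have hlim : Tendsto (fun j => ∫ x in Ω, g j x ^ 2 * q x ∂μ) atTop (𝓝 (∫ x in K, q x ∂μ)) := by
    have hKint : ∫ x in K, q x ∂μ = ∫ x in Ω, K.indicator q x ∂μ := by
      rw [setIntegral_indicator hK.measurableSet, inter_eq_self_of_subset_right hKΩ]
    rw [hKint]
    refine tendsto_integral_of_dominated_convergence
      ((Metric.cthickening δ K).indicator fun x => ‖q x‖) (fun j => ?_) ?_ (fun j => ?_) ?_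
    · exact ((g_diff j).continuous.pow 2).aestronglyMeasurable.mul hq.aestronglyMeasurable
    · refine Integrable.integrableOn ?_
      rw [integrable_indicator_iff hL.measurableSet]
      exact (hq.integrableOn_compact_subset hδ hL).norm
    · filter_upwards with x
      by_cases hx : x ∈ Metric.cthickening δ K
      · rw [indicator_of_mem hx, norm_mul]
        have h1 := g_range j (mem_range_self x)
        refine mul_le_of_le_one_left (norm_nonneg _) ?_
        rw [Real.norm_of_nonneg (sq_nonneg _)]
        exact pow_le_one₀ h1.1 h1.2
      · have : g j x = 0 := by
          rw [← Function.notMem_support]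
          exact fun hx' => hx (hsub j hx')
        simp [this, indicator_of_notMem hx]
    · filter_upwards with x
      by_cases hx : x ∈ K
      · simp [hg _ x hx, hx]
      · rw [indicator_of_notMem hx]
        refine tendsto_const_nhds.congr' ?_
        obtain ⟨ε, εpos, hε⟩ : ∃ ε, 0 < ε ∧ x ∉ Metric.thickening ε K := by
          rw [← hK.isClosed.closure_eq, Metric.closure_eq_iInter_thickening K] at hx
          simpa using hx
        filter_upwards [(tendsto_order.1 u_lim).2 _ εpos] with j hj
        have : g j x = 0 := by
          rw [← Function.notMem_support, g_supp]
          exact fun hx' => hε (Metric.thickening_mono hj.le K hx')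
        simp [this]
  exact ge_of_tendsto' hlim fun j =>
    h _ (g_diff j) (hL.of_isClosed_subset (isClosed_tsupport _) (hts j)) ((hts j).trans hδ)

/-- If q were negative on a set of positive measure, inner regularity would give a compact subset of
positive measure with negative integral. A measurable representative makes the negativity set
measurable. -/
theorem ae_nonneg_of_forall_setIntegral_isCompact_nonneg {E : Type*} [NormedAddCommGroup E]
    [NormedSpace ℝ E] [FiniteDimensional ℝ E] [MeasurableSpace E] [BorelSpace E] {μ : Measure E}
    [μ.InnerRegular] {Ω : Set E} (hΩ : IsOpen Ω) {q : E → ℝ} (hq : LocallyIntegrableOn q Ω μ)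
    (h : ∀ K, IsCompact K → K ⊆ Ω → 0 ≤ ∫ x in K, q x ∂μ) :
    ∀ᵐ x ∂(μ.restrict Ω), 0 ≤ q x := by
  have hm : AEStronglyMeasurable q (μ.restrict Ω) := hq.aestronglyMeasurable
  set q' := hm.mk q
  have hqq' : q =ᵐ[μ.restrict Ω] q' := hm.ae_eq_mk
  set T := Ω ∩ {x | q' x < 0}
  have hTm : MeasurableSet T := hΩ.measurableSet.inter
    (measurableSet_lt hm.stronglyMeasurable_mk.measurable measurable_const)
  have hT : μ T = 0 := by
    by_contra hne
    obtain ⟨K, hKT, hK, hKpos⟩ := hTm.exists_lt_isCompact (pos_iff_ne_zero.mpr hne)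
    have hKΩ : K ⊆ Ω := hKT.trans inter_subset_left
    have hneg : ∀ᵐ x ∂(μ.restrict K), q x < 0 := by
      filter_upwards [ae_restrict_of_ae_restrict_of_subset hKΩ hqq',
        ae_restrict_mem hK.measurableSet] with x hx hxK
      rw [hx]
      exact (hKT hxK).2
    have hi : Integrable q (μ.restrict K) := hq.integrableOn_compact_subset hKΩ hK
    have h0 : 0 ≤ᵐ[μ.restrict K] fun x => -q x := hneg.mono fun x hx => by
      simpa using hx.le
    have hz : ∫ x in K, -q x ∂μ = 0 := by
      refine le_antisymm ?_ (integral_nonneg_of_ae h0)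
      rw [integral_neg]
      linarith [h K hK hKΩ]
    have hz' := (integral_eq_zero_iff_of_nonneg_ae h0 hi.neg).mp hz
    have hfalse : ∀ᵐ _ ∂(μ.restrict K), False := by
      filter_upwards [hz', hneg] with x h1 h2
      simp only [Pi.zero_apply] at h1
      linarith
    rw [ae_iff] at hfalse
    simp only [not_false_eq_true] at hfalse
    have : μ K = 0 := by simpa using hfalse
    exact hKpos.ne' this
  have hT' : ∀ᵐ x ∂(μ.restrict Ω), x ∉ T := ae_restrict_of_ae (measure_eq_zero_iff_ae_notMem.mp hT)
  filter_upwards [hqq', hT', ae_restrict_mem hΩ.measurableSet] with x h1 h2 h3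
  rw [h1]
  by_contra hc
  exact h2 ⟨h3, not_le.mp hc⟩

end Localization

/-! ### Necessity of the eigenvalue condition -/

section Necessity

variable {n m : ℕ} {φ : ℝ → ℝ}

theorem locallyIntegrableOn_inner_realAct {Ω : Set (EuclideanSpace ℝ (Fin n))} (hΩ : IsOpen Ω)
    {M : EuclideanSpace ℝ (Fin n) → Matrix (Fin m) (Fin m) ℝ}
    (hM : ∀ i j, LocallyIntegrableOn (fun x => M x i j) Ω volume)
    (p q : EuclideanSpace ℂ (Fin m)) :
    LocallyIntegrableOn (fun x => inner ℝ p (realAct (M x) q)) Ω volume := by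
  rw [locallyIntegrableOn_iff hΩ.isLocallyClosed]
  intro K hKΩ hK
  simp only [inner_realAct_eq_sum]
  exact integrable_finsetSum _ fun i _ => integrable_finsetSum _ fun j _ =>
    ((hM i j).integrableOn_compact_subset hKΩ hK).mul_const _

theorem ae_quadratic_nonneg_apply (hφ : Admissible φ) {Ω : Set (EuclideanSpace ℝ (Fin n))}
    (hΩ : IsOpen Ω) {A : Fin n → EuclideanSpace ℝ (Fin n) → Matrix (Fin m) (Fin m) ℝ}
    (hA : ∀ h i j, LocallyIntegrableOn (fun x => A h x i j) Ω volume)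
    (hD : LPhiDissipative φ Ω (diagCoeff A)) (h : Fin n) {s : ℝ} (hs : 0 < s)
    (w ξ : EuclideanSpace ℂ (Fin m)) : ∀ᵐ x ∂(volume.restrict Ω),
      0 ≤ ‖w‖ ^ 2 * inner ℝ ξ (realAct (A h x) ξ) +
        logDer φ s * (inner ℝ w ξ * inner ℝ w (realAct (A h x) ξ)) := by
  rcases eq_or_ne w 0 with rfl | hw
  · simp
  have hwn := norm_pos_iff.mpr hw
  -- The form is homogeneous of degree 2 in w, so w may be rescaled to norm s, the point at which
  -- the logarithmic derivative is evaluated.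
  set z := (s * ‖w‖⁻¹) • w with hzw
  have hz : z ≠ 0 := smul_ne_zero (by positivity) hw
  have hzn : ‖z‖ = s := by
    rw [hzw, norm_smul, Real.norm_of_nonneg (by positivity)]
    field_simp
  have hloc := locallyIntegrableOn_inner_realAct hΩ (hA h) (fderiv ℝ (radialMap φ) z ξ) ξ
  have hnn := ae_nonneg_of_forall_setIntegral_isCompact_nonneg hΩ hloc fun K hK hKΩ =>
    setIntegral_nonneg_of_integral_sq_mul_nonneg hΩ hloc (fun η h1 h2 h3 =>
      integral_sq_mul_nonneg hφ hΩ hA hD h1 h2 h3 hz ξ h) hK hKΩ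
  filter_upwards [hnn] with x hx
  rw [inner_fderiv_radialMap hφ hz, hzn, hzw, real_inner_smul_left, real_inner_smul_left] at hx
  have hpos : 0 < φ s / ‖w‖ ^ 2 := div_pos (hφ.pos s hs) (by positivity)
  refine nonneg_of_mul_nonneg_right (hx.trans_eq ?_) hpos
  field_simp

theorem nonneg_of_dense {Y : Type*} [TopologicalSpace Y] {F : Y → ℝ} (hF : Continuous F)
    {D : Set Y} (hD : Dense D) (h : ∀ p ∈ D, 0 ≤ F p) (p : Y) : 0 ≤ F p := by
  have hcl : IsClosed {y | 0 ≤ F y} := isClosed_le continuous_const hF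
  have hsub : D ⊆ {y | 0 ≤ F y} := h
  exact closure_minimal hsub hcl (hD p)

theorem forall_quadratic_nonneg_of_dense (M : Matrix (Fin m) (Fin m) ℝ) (X : ℝ)
    {D : Set (EuclideanSpace ℂ (Fin m) × EuclideanSpace ℂ (Fin m))} (hD : Dense D)
    (h : ∀ p ∈ D, 0 ≤ ‖p.1‖ ^ 2 * inner ℝ p.2 (realAct M p.2) +
      X * (inner ℝ p.1 p.2 * inner ℝ p.1 (realAct M p.2))) (w ξ : EuclideanSpace ℂ (Fin m)) :
    0 ≤ ‖w‖ ^ 2 * inner ℝ ξ (realAct M ξ) + X * (inner ℝ w ξ * inner ℝ w (realAct M ξ)) := by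
  have hT : Continuous (realAct M) := LinearMap.continuous_of_finiteDimensional _
  have hc : Continuous fun p : EuclideanSpace ℂ (Fin m) × EuclideanSpace ℂ (Fin m) =>
      ‖p.1‖ ^ 2 * inner ℝ p.2 (realAct M p.2) +
      X * (inner ℝ p.1 p.2 * inner ℝ p.1 (realAct M p.2)) := by
    have hT2 := hT.comp (continuous_snd (X := EuclideanSpace ℂ (Fin m)))
    exact ((continuous_fst.norm.pow 2).mul (continuous_snd.inner hT2)).add
      (continuous_const.mul ((continuous_fst.inner continuous_snd).mul (continuous_fst.inner hT2)))
  exact nonneg_of_dense hc hD h (w, ξ)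

/-- The exceptional null set of `ae_quadratic_nonneg_apply` depends on (w, ξ). A countable dense
family gives one null set, and continuity in (w, ξ) does the rest. -/
theorem ae_quadratic_nonneg (hφ : Admissible φ) {Ω : Set (EuclideanSpace ℝ (Fin n))}
    (hΩ : IsOpen Ω) {A : Fin n → EuclideanSpace ℝ (Fin n) → Matrix (Fin m) (Fin m) ℝ}
    (hA : ∀ h i j, LocallyIntegrableOn (fun x => A h x i j) Ω volume)
    (hD : LPhiDissipative φ Ω (diagCoeff A)) (h : Fin n) {s : ℝ} (hs : 0 < s) :
    ∀ᵐ x ∂(volume.restrict Ω), ∀ w ξ : EuclideanSpace ℂ (Fin m),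
      0 ≤ ‖w‖ ^ 2 * inner ℝ ξ (realAct (A h x) ξ) +
        logDer φ s * (inner ℝ w ξ * inner ℝ w (realAct (A h x) ξ)) := by
  obtain ⟨D, hDc, hDd⟩ := TopologicalSpace.exists_countable_dense
    (EuclideanSpace ℂ (Fin m) × EuclideanSpace ℂ (Fin m))
  have hae := (ae_ball_iff hDc).mpr fun p (_ : p ∈ D) =>
    ae_quadratic_nonneg_apply hφ hΩ hA hD h hs p.1 p.2
  filter_upwards [hae] with x hx w ξ
  exact forall_quadratic_nonneg_of_dense _ _ hDd hx w ξ

theorem pinching_of_lPhiDissipative (hm : 1 ≤ m) (hφ : Admissible φ)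
    {Ω : Set (EuclideanSpace ℝ (Fin n))} (hΩ : IsOpen Ω)
    {A : Fin n → EuclideanSpace ℝ (Fin n) → Matrix (Fin m) (Fin m) ℝ}
    (hA : ∀ h i j, LocallyIntegrableOn (fun x => A h x i j) Ω volume)
    (hA_symm : ∀ h, ∀ᵐ x ∂(volume.restrict Ω), (A h x).IsSymm)
    (hA_pos : ∀ h, ∀ᵐ x ∂(volume.restrict Ω),
      ∀ ξ : Fin m → ℝ, ξ ≠ 0 → 0 < dotProduct ((A h x).mulVec ξ) ξ)
    (hD : LPhiDissipative φ Ω (diagCoeff A)) (h : Fin n) :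
    ∀ᵐ x ∂(volume.restrict Ω),
      LamInf φ ^ 2 * (minEigenvalue (A h x) + maxEigenvalue (A h x)) ^ 2 ≤
        4 * minEigenvalue (A h x) * maxEigenvalue (A h x) := by
  -- Only the positive integers s = N + 1 are used: countably many radii share one null set, and N →
  -- ∞ reaches Λ_∞.
  have hall : ∀ᵐ x ∂(volume.restrict Ω), ∀ N : ℕ, ∀ w ξ : EuclideanSpace ℂ (Fin m),
      0 ≤ ‖w‖ ^ 2 * inner ℝ ξ (realAct (A h x) ξ) +
        logDer φ (N + 1) * (inner ℝ w ξ * inner ℝ w (realAct (A h x) ξ)) :=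
    ae_all_iff.mpr fun N => ae_quadratic_nonneg hφ hΩ hA hD h N.cast_add_one_pos
  filter_upwards [hall, hA_symm h, hA_pos h] with x hx hsymm hpos
  have hM : (A h x).IsHermitian := by simpa using hsymm
  have ha := minEigenvalue_pos hM hm hpos
  obtain ⟨i, hi⟩ := exists_eigenvalues_eq_min hM hm
  obtain ⟨j, hj⟩ := exists_eigenvalues_eq_max hM hm
  obtain ⟨e, f, he, hf, hef, hTe, hTf⟩ := exists_unit_eigenvector hM i j
  rw [hi] at hTe
  rw [hj] at hTf
  have hN : ∀ N : ℕ, (logDer φ (N + 1) / (logDer φ (N + 1) + 2)) ^ 2 *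
      (minEigenvalue (A h x) + maxEigenvalue (A h x)) ^ 2 ≤
        4 * minEigenvalue (A h x) * maxEigenvalue (A h x) := fun N =>
    pinching_of_quadratic_nonneg ha (minEigenvalue_le_maxEigenvalue hM hm)
      (neg_one_lt_logDer hφ N.cast_add_one_pos) (realAct (A h x)) he hf
      (fun hne => hef fun hij => hne (by rw [← hi, ← hj, hij])) hTe hTf (hx N)
  have hlim : Tendsto (fun N : ℕ => (logDer φ (N + 1) / (logDer φ (N + 1) + 2)) ^ 2) atTop
      (𝓝 (LamInf φ ^ 2)) :=
    (tendsto_logDer_ratio_sq hφ).comp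
      (tendsto_atTop_add_const_right atTop 1 tendsto_natCast_atTop_atTop)
  exact le_of_tendsto' (hlim.mul_const _) hN

end Necessity

end FunctionalDissipativity

end

theorem mainTheorem7 (n m : ℕ) (hm : 1 ≤ m)
    (φ : ℝ → ℝ) (hφ : FunctionalDissipativity.Admissible φ)
    (Ω : Set (EuclideanSpace ℝ (Fin n))) (hΩ_open : IsOpen Ω) (hΩ_conn : IsConnected Ω)
    (A : Fin n → EuclideanSpace ℝ (Fin n) → Matrix (Fin m) (Fin m) ℝ)
    (hA_loc : ∀ h i j, LocallyIntegrableOn (fun x => A h x i j) Ω volume)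
    (hA_symm : ∀ h, ∀ᵐ x ∂(volume.restrict Ω), (A h x).IsSymm)
    (hA_pos : ∀ h, ∀ᵐ x ∂(volume.restrict Ω),
      ∀ ξ : Fin m → ℝ, ξ ≠ 0 → 0 < dotProduct ((A h x).mulVec ξ) ξ) :
    (FunctionalDissipativity.LPhiDissipative φ Ω (FunctionalDissipativity.diagCoeff A) ↔
      ∀ h, ∀ᵐ x ∂(volume.restrict Ω),
        FunctionalDissipativity.LamInf φ ^ 2 *
            (FunctionalDissipativity.minEigenvalue (A h x) +
              FunctionalDissipativity.maxEigenvalue (A h x)) ^ 2 ≤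
          4 * FunctionalDissipativity.minEigenvalue (A h x) *
            FunctionalDissipativity.maxEigenvalue (A h x)) ∧
    (m = 2 →
      ((∀ h, ∀ᵐ x ∂(volume.restrict Ω),
        FunctionalDissipativity.LamInf φ ^ 2 *
            (FunctionalDissipativity.minEigenvalue (A h x) +
              FunctionalDissipativity.maxEigenvalue (A h x)) ^ 2 ≤
          4 * FunctionalDissipativity.minEigenvalue (A h x) *
            FunctionalDissipativity.maxEigenvalue (A h x)) ↔
      ∀ h, ∀ᵐ x ∂(volume.restrict Ω),
        FunctionalDissipativity.LamInf φ ^ 2 * (A h x).trace ^ 2 ≤ 4 * (A h x).det)) := by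
  refine ⟨⟨fun hD => FunctionalDissipativity.pinching_of_lPhiDissipative hm hφ hΩ_open hA_loc
    hA_symm hA_pos hD, FunctionalDissipativity.lPhiDissipative_of_pinching hm hφ hA_symm hA_pos⟩,
    ?_⟩
  rintro rfl
  refine forall_congr' fun h => eventually_congr ?_
  filter_upwards [hA_symm h] with x hx
  obtain ⟨h1, h2⟩ := FunctionalDissipativity.trace_eq_min_add_max
    (M := A h x) (by simpa using hx)
  rw [h1, h2, mul_assoc]
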